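/- Let $R$ be a principal ideal domain, $0 \ne n \in R$, let $<$ be a global monomial order on monomials in finitely many variables $x$, and let $f_1,\dots,f_k \in R[x]$. For a commutative ring $A$ and $0\ne f\in A[x]$ write $\mathrm{lt}(f)$, $\mathrm{lm}(f)$, $\mathrm{lc}(f)$ for the lead term, lead monomial and lead coefficient. A finite set $G$ is a *strong Gröbner basis* of an ideal $I\subseteq A[x]$ if $G\subseteq I$, the lead terms of $G$ and of $I$ generate the same ideal, and for every $0\neq f\in I$ there is $0\ne g\in G$ with $\mathrm{lt}(g)\mid \mathrm{lt}(f)$. *Polynomials.* For nonzero $f,g \in A[x]$ let $t=\mathrm{lcm}(\mathrm{lm} f,\mathrm{lm} g)$. An *S-polynomial* is $a_f\frac{t}{\mathrm{lm} f}f-a_g\frac{t}{\mathrm{lm} g}g$, where $a_f\,\mathrm{lc}(f)=a_g\,\mathrm{lc}(g)=a$ and $aA=\mathrm{lc}(f)A\cap \mathrm{lc}(g)A$. A *GCD-polynomial* is $b_f\frac{t}{\mathrm{lm} f}f+b_g\frac{t}{\mathrm{lm} g}g$, where $b_f\,\mathrm{lc}(f)+b_g\,\mathrm{lc}(g)$ generates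 $\mathrm{lc}(f)A+ \mathrm{lc}(g)A$. An *annihilator polynomial* of $f$ is $af$, where $a$ generates the annihilator of $\mathrm{lc}(f)$. If $\mathrm{lm}(g)\mid \mathrm{lm}(h)$ and $c\,\mathrm{lc}(g)=\mathrm{lc}(h)$, then $h-c\frac{\mathrm{lm}(h)}{\mathrm{lm}(g)}g$ is a *top-reduction* of $h$ by $g$. *Ring Buchberger algorithm.* Start with $G$ the set of nonzero inputs and $P$ the set of one S-polynomial and one GCD-polynomial for each pair of nonzero inputs and one annihilator polynomial for each nonzero input. While $P\neq\emptyset$: remove some $h$ from $P$; replace $h$ by top-reductions by elements of $G$ as long as $h\neq 0$ and one is possible; if the result $h$ is nonzero, add to $P$ an annihilator polynomial of $h$ and, for each $g\in G$, an S-polynomial and a GCD-polynomial of $g$ and $h$, and then add $h$ to $G$. Return $G$. *Splitting algorithm over $R/nR$*, on input $f_1,\dots,f_k$: 1. Run the Buchberger algorithm on the $f_i \bmod n$, as over a field (only S-polynomials) or with all three kinds of polynomials, but stop if a nonzero input, or a nonzero $h$ about to be added to $G$, has a non-invertible lead coefficient $\bar a\in R/nR$. If it finishes without stopping, return its result. 2.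 Otherwise let $a \in R$ represent $\bar a$, and either find coprime non-units $p,q\in R$ with $n=pq$, or find $r\in R$, $e>1$ with $nR=r^eR$ and $r\mid a$. 3. In the second case, run the ring Buchberger algorithm on the $f_i\bmod n$ and return its result. 4. In the first case, run the splitting algorithm on $f_1,\dots,f_k$ over $R/pR$ and over $R/qR$, with results $G_p$, $G_q$. Let $L_p\subset (R/nR)[x]$ consist of the constant $p$ and, for each nonzero $g\in G_p$, of a lift $g'$ of some unit multiple of $g$ such that $\mathrm{lc}(g')$ divides $p$ and is not divisible by $p$ in $R/nR$; define $L_q$ likewise. With $u,v\in R/nR$ such that $up+vq=1$, return the set of all $$up\,\frac{\mathrm{lcm}(\mathrm{lm}\,g,\mathrm{lm}\,h)}{\mathrm{lm}\,h}\,\mathrm{lc}(g)\,h+vq\,\frac{\mathrm{lcm}(\mathrm{lm}\,g,\mathrm{lm}\,h)}{\mathrm{lm}\,g}\,\mathrm{lc}(h)\,g\qquad(g\in L_p,\ h\in L_q).$$ **Theorem.** The splitting algorithm terminates and is correct: for all choices that it leaves open, each of its runs is finite, each of its steps can be carried out (no run gets stuck before a result is returned), and the returned set is a strong Gröbner basis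 of the ideal $\langle f_1\bmod n,\dots,f_k\bmod n\rangle\subseteq (R/nR)[x]$. -/

import Mathlib

namespace SplitGB

open MvPolynomial

noncomputable section

section Polynomials

variable {σ A : Type*} [CommRing A] (m : MonomialOrder σ)

/-- The ideal generated by the lead terms of the elements of `F`. -/
def leadIdeal (F : Set (MvPolynomial σ A)) : Ideal (MvPolynomial σ A) :=
  Ideal.span (m.leadingTerm '' F)

/-- `G` is a Gröbner basis of `I`. -/
def IsGroebnerBasis (G : Finset (MvPolynomial σ A)) (I : Ideal (MvPolynomial σ A)) : Prop :=
  (G : Set (MvPolynomial σ A)) ⊆ I ∧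
    leadIdeal m (G : Set (MvPolynomial σ A)) = leadIdeal m (I : Set (MvPolynomial σ A))

/-- `G` is a strong Gröbner basis of `I`. As the lead term of `0` is `0` here, which divides no
nonzero term, the element `g` below is automatically nonzero. -/
def IsStrongGroebnerBasis (G : Finset (MvPolynomial σ A)) (I : Ideal (MvPolynomial σ A)) : Prop :=
  IsGroebnerBasis m G I ∧
    ∀ f ∈ I, f ≠ 0 → ∃ g ∈ G, m.leadingTerm g ∣ m.leadingTerm f

/-- `g` top-reduces `f`: the lead monomial and the lead coefficient of `g` divide those of `f`. -/
def TopReduces (g f : MvPolynomial σ A) : Prop :=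
  m.degree g ≤ m.degree f ∧ m.leadingCoeff g ∣ m.leadingCoeff f

/-- `f'` is a top-reduction of `f` by `g`, for some choice `c` of the quotient of the lead
coefficients. -/
def IsTopReduction (g f f' : MvPolynomial σ A) : Prop :=
  m.degree g ≤ m.degree f ∧ ∃ c : A, c * m.leadingCoeff g = m.leadingCoeff f ∧
    f' = f - monomial (m.degree f - m.degree g) c * g

/-- `s` is an S-polynomial of `f` and `g`; `a` is a least common multiple of the lead
coefficients. -/
def IsSPoly (f g s : MvPolynomial σ A) : Prop :=
  ∃ a af ag : A,
    Ideal.span {a} = Ideal.span {m.leadingCoeff f} ⊓ Ideal.span {m.leadingCoeff g} ∧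
    af * m.leadingCoeff f = a ∧ ag * m.leadingCoeff g = a ∧
    s = monomial (m.degree f ⊔ m.degree g - m.degree f) af * f
      - monomial (m.degree f ⊔ m.degree g - m.degree g) ag * g

/-- `s` is a GCD-polynomial of `f` and `g`; `b` is a greatest common divisor of the lead
coefficients. -/
def IsGCDPoly (f g s : MvPolynomial σ A) : Prop :=
  ∃ b bf bg : A,
    Ideal.span {b} = Ideal.span {m.leadingCoeff f} ⊔ Ideal.span {m.leadingCoeff g} ∧
    b = bf * m.leadingCoeff f + bg * m.leadingCoeff g ∧
    s = monomial (m.degree f ⊔ m.degree g - m.degree f) bf * f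
      + monomial (m.degree f ⊔ m.degree g - m.degree g) bg * g

/-- `s` is an annihilator polynomial of `f`. -/
def IsAnnPoly (f s : MvPolynomial σ A) : Prop :=
  ∃ a : A, Ideal.span {a} = (Ideal.span {m.leadingCoeff f}).annihilator ∧ s = C a * f

/-- `G` is the initial basis of Buchberger's algorithm on `F 0, …, F (k-1)`; zero polynomials,
which have no lead term, are left out. -/
def IsInitialBasis {k : ℕ} (F : Fin k → MvPolynomial σ A) (G : Finset (MvPolynomial σ A)) : Prop :=
  ∀ g, g ∈ G ↔ g ≠ 0 ∧ ∃ i, g = F i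

/-- `P` is an initial pair set of Buchberger's algorithm: it holds one S-polynomial for each pair
of (nonzero) inputs and, if `all` holds, also one GCD-polynomial for each pair and one annihilator
polynomial for each input. -/
def IsInitialPairSet (all : Prop) {k : ℕ} (F : Fin k → MvPolynomial σ A)
    (P : Finset (MvPolynomial σ A)) : Prop :=
  ∃ (S T : Fin k → Fin k → MvPolynomial σ A) (U : Fin k → MvPolynomial σ A),
    (∀ i j, F i ≠ 0 → F j ≠ 0 → IsSPoly m (F i) (F j) (S i j) ∧ IsGCDPoly m (F i) (F j) (T i j)) ∧
    (∀ i, F i ≠ 0 → IsAnnPoly m (F i) (U i)) ∧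
    ∀ h, h ∈ P ↔
      (∃ i j, i < j ∧ F i ≠ 0 ∧ F j ≠ 0 ∧ (h = S i j ∨ (all ∧ h = T i j))) ∨
      (all ∧ ∃ i, F i ≠ 0 ∧ h = U i)

/-- `Q` is a set of new pairs caused by the new element `h` of the basis `G`. -/
def IsNewPairSet (all : Prop) (G : Finset (MvPolynomial σ A)) (h : MvPolynomial σ A)
    (Q : Finset (MvPolynomial σ A)) : Prop :=
  ∃ (S T : MvPolynomial σ A → MvPolynomial σ A) (U : MvPolynomial σ A),
    (∀ g ∈ G, IsSPoly m g h (S g) ∧ IsGCDPoly m g h (T g)) ∧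
    IsAnnPoly m h U ∧
    ∀ x, x ∈ Q ↔ (∃ g ∈ G, x = S g ∨ (all ∧ x = T g)) ∨ (all ∧ x = U)

end Polynomials

section Machine

variable {R : Type*} [CommRing R] {σ : Type*}

/-- The residue class ring `R/nR`. -/
abbrev Residue (n : R) : Type _ := R ⧸ Ideal.span ({n} : Set R)

/-- The residue class map `R → R/nR`. -/
abbrev res (n : R) : R →+* Residue n := Ideal.Quotient.mk _

/-- Polynomials over `R/nR`. -/
abbrev Poly (σ : Type*) (n : R) : Type _ := MvPolynomial σ (Residue n)

/-- The polynomials `f_i mod n`. -/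
def reduceMod {k : ℕ} (f : Fin k → MvPolynomial σ R) (n : R) : Fin k → Poly σ n :=
  fun i => map (res n) (f i)

/-- `g'` over `R/nR` is a lift of a unit multiple of `g` over `R/pR` (where `p ∣ n`), such that the
lead coefficient of `g'` divides `p` and is not divisible by `p`. -/
def IsNormalizedLift (m : MonomialOrder σ) (n p : R) (g : Poly σ p) (g' : Poly σ n) : Prop :=
  (∃ (u : (Residue p)ˣ) (e : MvPolynomial σ R),
    map (res p) e = C (u : Residue p) * g ∧ map (res n) e = g') ∧
  m.leadingCoeff g' ∣ res n p ∧ ¬ res n p ∣ m.leadingCoeff g'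

/-- `L` consists of the constant `p` and of one normalized lift of each nonzero element of `G`. -/
def IsLiftedBasis (m : MonomialOrder σ) (n p : R) (G : Finset (Poly σ p))
    (L : Finset (Poly σ n)) : Prop :=
  ∃ l : Poly σ p → Poly σ n, (∀ g ∈ G, g ≠ 0 → IsNormalizedLift m n p g (l g)) ∧
    ∀ x, x ∈ L ↔ x = C (res n p) ∨ ∃ g ∈ G, g ≠ 0 ∧ x = l g

/-- The recombination of `ga` and `gb`, for coefficients with `u * a + v * b = 1`. -/
def combine {A : Type*} [CommRing A] (m : MonomialOrder σ) (u v a b : A)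
    (ga gb : MvPolynomial σ A) : MvPolynomial σ A :=
  C (u * a) * (monomial (m.degree ga ⊔ m.degree gb - m.degree gb) (m.leadingCoeff ga) * gb)
    + C (v * b) * (monomial (m.degree ga ⊔ m.degree gb - m.degree ga) (m.leadingCoeff gb) * ga)

/-- `G` over `R/nR`, where `n = p * q`, is a recombination of `Gp` over `R/pR` and `Gq` over
`R/qR`. -/
def IsRecombination (m : MonomialOrder σ) (n p q : R) (Gp : Finset (Poly σ p))
    (Gq : Finset (Poly σ q)) (G : Finset (Poly σ n)) : Prop :=
  ∃ (Lp Lq : Finset (Poly σ n)) (u v : Residue n),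
    IsLiftedBasis m n p Gp Lp ∧ IsLiftedBasis m n q Gq Lq ∧
    u * res n p + v * res n q = 1 ∧
    ∀ x, x ∈ G ↔ ∃ ga ∈ Lp, ∃ gb ∈ Lq, x = combine m u v (res n p) (res n q) ga gb

/-- The two places where the algorithm runs Buchberger's algorithm: the `trial` pass, which stops
at a non-invertible lead coefficient, and the fallback pass `full`, which never stops early. -/
inductive Pass : Type
  | trial : Pass
  | full : Pass

/-- Whether a pass forms GCD-polynomials and annihilator polynomials, too: the full pass does; the
trial pass does so or not according to the flag `b`. -/
def Pass.FormsAll (b : Bool) : Pass → Prop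
  | .trial => b = true
  | .full => True

/-- Configurations of the splitting algorithm over `R/nR`. -/
inductive Config (R : Type*) [CommRing R] (σ : Type*) : R → Type _
  /-- nothing has been done yet -/
  | start {n : R} : Config R σ n
  /-- at the head of the main loop of Buchberger's algorithm, with basis `G` and pairs `P` -/
  | loop {n : R} (pass : Pass) (G P : Finset (Poly σ n)) : Config R σ n
  /-- inside Buchberger's algorithm, computing a normal form; `h` is the current remainder -/
  | nf {n : R} (pass : Pass) (G P : Finset (Poly σ n)) (h : Poly σ n) : Config R σ n
  /-- the trial pass stopped at the class of `a` -/
  | stopped {n : R} (a : R) : Config R σ n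
  /-- the recursive calls over `R/pR` and `R/qR` are running -/
  | split {n : R} (p q : R) (cp : Config R σ p) (cq : Config R σ q) : Config R σ n
  /-- the algorithm has returned `G` -/
  | done {n : R} (G : Finset (Poly σ n)) : Config R σ n

open Classical in
/-- One step of the splitting algorithm on `f_0, …, f_{k-1}`. All choices that the algorithm leaves
open (order of the pairs, reducers, quotients, Bézout coefficients, generators, lifts, the outcome
of the splitting subroutine, the interleaving of the recursive calls) are nondeterministic. -/
inductive Step (m : MonomialOrder σ) (b : Bool) {k : ℕ} (f : Fin k → MvPolynomial σ R) :
    {n : R} → Config R σ n → Config R σ n → Prop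
  /-- a nonzero input has a non-invertible lead coefficient -/
  | startStop {n : R} (i : Fin k) (a : R) (hi : reduceMod f n i ≠ 0)
      (hu : ¬ IsUnit (m.leadingCoeff (reduceMod f n i)))
      (ha : res n a = m.leadingCoeff (reduceMod f n i)) :
      Step m b f (Config.start : Config R σ n) (.stopped a)
  /-- initialization of the trial pass -/
  | startTrial {n : R} (G P : Finset (Poly σ n))
      (hu : ∀ i, reduceMod f n i ≠ 0 → IsUnit (m.leadingCoeff (reduceMod f n i)))
      (hG : IsInitialBasis (reduceMod f n) G)
      (hP : IsInitialPairSet m (Pass.FormsAll b .trial) (reduceMod f n) P) :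
      Step m b f Config.start (.loop .trial G P)
  /-- choose a pair and remove it -/
  | choose {n : R} (pass : Pass) (G P : Finset (Poly σ n)) (h : Poly σ n) (hh : h ∈ P) :
      Step m b f (.loop pass G P) (.nf pass G (P.erase h) h)
  /-- one step of the normal form computation -/
  | topReduce {n : R} (pass : Pass) (G P : Finset (Poly σ n)) (g h h' : Poly σ n)
      (h0 : h ≠ 0) (hg : g ∈ G) (hr : IsTopReduction m g h h') :
      Step m b f (.nf pass G P h) (.nf pass G P h')
  /-- the normal form is zero -/
  | nfZero {n : R} (pass : Pass) (G P : Finset (Poly σ n)) :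
      Step m b f (.nf pass G P 0) (.loop pass G P)
  /-- the normal form `h` is nonzero and is added to the basis -/
  | nfAdd {n : R} (pass : Pass) (G P Q : Finset (Poly σ n)) (h : Poly σ n) (h0 : h ≠ 0)
      (hr : ∀ g ∈ G, ¬ TopReduces m g h)
      (hu : pass = .trial → IsUnit (m.leadingCoeff h))
      (hQ : IsNewPairSet m (Pass.FormsAll b pass) G h Q) :
      Step m b f (.nf pass G P h) (.loop pass (insert h G) (P ∪ Q))
  /-- the trial pass meets a nonzero normal form with non-invertible lead coefficient -/
  | nfStop {n : R} (G P : Finset (Poly σ n)) (h : Poly σ n) (a : R) (h0 : h ≠ 0)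
      (hr : ∀ g ∈ G, ¬ TopReduces m g h)
      (hu : ¬ IsUnit (m.leadingCoeff h)) (ha : res n a = m.leadingCoeff h) :
      Step m b f (.nf .trial G P h) (.stopped a)
  /-- no pairs are left: return the basis -/
  | finish {n : R} (pass : Pass) (G : Finset (Poly σ n)) :
      Step m b f (.loop pass G ∅) (.done G)
  /-- the splitting subroutine finds coprime non-units `p`, `q` with `n = p * q` -/
  | splitFound {n : R} (a p q : R) (hp : ¬ IsUnit p) (hq : ¬ IsUnit q) (hpq : IsCoprime p q)
      (hn : n = p * q) :
      Step m b f (Config.stopped a : Config R σ n) (.split p q .start .start)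
  /-- the splitting subroutine finds that `n` is, up to a unit, a proper power `r ^ e` with
  `r ∣ a`: run the full Buchberger algorithm -/
  | powerFound {n : R} (a r : R) (e : ℕ) (he : 1 < e) (hn : Associated n (r ^ e)) (hr : r ∣ a)
      (G P : Finset (Poly σ n))
      (hG : IsInitialBasis (reduceMod f n) G)
      (hP : IsInitialPairSet m (Pass.FormsAll b .full) (reduceMod f n) P) :
      Step m b f (.stopped a) (.loop .full G P)
  /-- a step of the recursive call over `R/pR` -/
  | left {n p q : R} (cp cp' : Config R σ p) (cq : Config R σ q) (h : Step m b f cp cp') :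
      Step m b f (Config.split p q cp cq : Config R σ n) (.split p q cp' cq)
  /-- a step of the recursive call over `R/qR` -/
  | right {n p q : R} (cp : Config R σ p) (cq cq' : Config R σ q) (h : Step m b f cq cq') :
      Step m b f (Config.split p q cp cq : Config R σ n) (.split p q cp cq')
  /-- both recursive calls have returned: recombine -/
  | recombine {n p q : R} (Gp : Finset (Poly σ p)) (Gq : Finset (Poly σ q))
      (G : Finset (Poly σ n)) (hG : IsRecombination m n p q Gp Gq G) :
      Step m b f (.split p q (.done Gp) (.done Gq)) (.done G)

/-- `c` can be reached by the algorithm over `R/nR` on the input `f_0, …, f_{k-1}`. -/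
def Reachable (m : MonomialOrder σ) (b : Bool) {k : ℕ} (f : Fin k → MvPolynomial σ R) {n : R}
    (c : Config R σ n) : Prop :=
  Relation.ReflTransGen (Step m b f) Config.start c

end Machine

end

end SplitGB

/-! Correctness is an invariant preserved by every step (`Step.inv`). In Buchberger's loop each
critical polynomial of `G` is pending, is the one being reduced, or already reduces to zero. With no
pairs left, the criterion `exists_topReduces_of_mem_span` applies. It takes a representation of `x`
by terms of degree at most `d`. GCD-polynomials supply one `k` in `G`, of degree dividing `d`, whose
lead coefficient divides those of all competitors. S-polynomials and annihilator polynomials rewrite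
every summand at `d` as a multiple of `k` plus lower terms. So `k` top-reduces `x`, or the bound `d`
drops. If all lead coefficients are units, as in the trial pass, S-polynomials suffice.

For `n = p * q`, the normalized lifts have lead coefficients dividing `p` and `q` respectively.
These are coprime, so if one lift from each side top-reduces `x`, the product of their lead
coefficients divides that of `x`, and this product is the lead coefficient of the combination
(`combine_topReduces`). The combination lies in the ideal because multiplication by `q` carries
membership modulo `p` to membership modulo `n` (`C_mul_map_mem_inputIdeal`).

No run gets stuck: a nonzero non-unit class modulo `n` shares a prime with `n`, which gives a
coprime splitting or a proper power (`exists_coprime_factors_or_power`). Runs are finite because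
exponents (Dickson) and lead coefficients in `R/nR` under divisibility are well-quasi-ordered, and
because splitting passes to proper divisors of `n`. -/

namespace SplitGB

open MvPolynomial MonomialOrder

/-! ### Representations of polynomials with bounded degree -/

section Representations

variable {σ A : Type*} [CommRing A] (m : MonomialOrder σ)

lemma degree_monomial_mul_le (s : σ →₀ ℕ) (c : A) (g : MvPolynomial σ A) :
    m.degree (monomial s c * g) ≼[m] s + m.degree g := by
  refine m.degree_mul_le.trans ?_
  rw [map_add, map_add]
  gcongr
  exact m.degree_monomial_le c

lemma coeff_monomial_mul_degree (s : σ →₀ ℕ) (c : A) (g : MvPolynomial σ A) :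
    (monomial s c * g).coeff (s + m.degree g) = c * m.leadingCoeff g := by
  rw [coeff_monomial_mul]; rfl

lemma degree_eq_of_coeff_ne_zero {x : MvPolynomial σ A} {d : σ →₀ ℕ}
    (hle : m.degree x ≼[m] d) (hd : x.coeff d ≠ 0) : m.degree x = d :=
  m.toSyn.injective (le_antisymm hle (m.le_degree (mem_support_iff.2 hd)))

lemma eq_zero_or_degree_lt {x : MvPolynomial σ A} {d : σ →₀ ℕ}
    (hle : m.degree x ≼[m] d) (hd : x.coeff d = 0) : x = 0 ∨ m.degree x ≺[m] d := by
  rcases hle.lt_or_eq with h | h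
  · exact .inr h
  · rw [← m.toSyn.injective h] at hd
    exact .inl (m.coeff_degree_eq_zero_iff.1 hd)

/-- The polynomials that are sums of terms times elements of `G`, where the degree of each term plus
the degree of the element of `G` is in `D`. -/
noncomputable def repSpan (G : Set (MvPolynomial σ A)) (D : Set m.syn) :
    Submodule A (MvPolynomial σ A) :=
  Submodule.span A {x | ∃ g ∈ G, ∃ (s : σ →₀ ℕ) (c : A),
    m.toSyn (s + m.degree g) ∈ D ∧ x = monomial s c * g}

variable {m}

lemma monomial_mul_mem_repSpan {G : Set (MvPolynomial σ A)} {D : Set m.syn}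
    {g : MvPolynomial σ A} (hg : g ∈ G) {s : σ →₀ ℕ} (c : A) (hs : m.toSyn (s + m.degree g) ∈ D) :
    monomial s c * g ∈ repSpan m G D :=
  Submodule.subset_span ⟨g, hg, s, c, hs, rfl⟩

lemma mem_repSpan_self {G : Set (MvPolynomial σ A)} {D : Set m.syn}
    {g : MvPolynomial σ A} (hg : g ∈ G) (hs : m.toSyn (m.degree g) ∈ D) : g ∈ repSpan m G D := by
  simpa using monomial_mul_mem_repSpan hg (s := 0) (1 : A) (by simpa using hs)

lemma repSpan_mono {G G' : Set (MvPolynomial σ A)} {D D' : Set m.syn} (hG : G ⊆ G') (hD : D ⊆ D') :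
    repSpan m G D ≤ repSpan m G' D' := by
  refine Submodule.span_mono ?_
  rintro x ⟨g, hg, s, c, hs, rfl⟩
  exact ⟨g, hG hg, s, c, hD hs, rfl⟩

lemma monomial_mul_repSpan {G : Set (MvPolynomial σ A)} {D D' : Set m.syn} {s : σ →₀ ℕ} (c : A)
    (hD : ∀ d ∈ D, m.toSyn s + d ∈ D') {x : MvPolynomial σ A} (hx : x ∈ repSpan m G D) :
    monomial s c * x ∈ repSpan m G D' := by
  induction hx using Submodule.span_induction with
  | mem x hx =>
    obtain ⟨g, hg, t, b, ht, rfl⟩ := hx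
    rw [← mul_assoc, monomial_mul]
    exact monomial_mul_mem_repSpan hg _ (by simpa [add_assoc] using hD _ ht)
  | zero => simp
  | add x y _ _ hx hy => rw [mul_add]; exact add_mem hx hy
  | smul a x _ hx => rw [mul_smul_comm]; exact Submodule.smul_mem _ _ hx

lemma coeff_eq_zero_of_mem_repSpan {G : Set (MvPolynomial σ A)} {D : Set m.syn} {e : σ →₀ ℕ}
    (hD : ∀ d ∈ D, d < m.toSyn e) {x : MvPolynomial σ A} (hx : x ∈ repSpan m G D) :
    x.coeff e = 0 := by
  induction hx using Submodule.span_induction with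
  | mem x hx =>
    obtain ⟨g, hg, t, b, ht, rfl⟩ := hx
    exact m.coeff_eq_zero_of_lt ((degree_monomial_mul_le m t b g).trans_lt (hD _ ht))
  | zero => simp
  | add x y _ _ hx hy => simp [hx, hy]
  | smul a x _ hx => simp [hx]

/-- Only finitely many summands occur, so their degrees have a maximum below `d`; this feeds the
induction on the degree bound. The case `x = 0` is separate because nothing may lie below `d`. -/
lemma repSpan_Iio {G : Set (MvPolynomial σ A)} {d : m.syn} {x : MvPolynomial σ A}
    (hx : x ∈ repSpan m G (Set.Iio d)) : x = 0 ∨ ∃ d' < d, x ∈ repSpan m G (Set.Iic d') := by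
  induction hx using Submodule.span_induction with
  | mem x hx =>
    obtain ⟨g, hg, t, b, ht, rfl⟩ := hx
    exact .inr ⟨_, ht, monomial_mul_mem_repSpan hg _ (Set.mem_Iic.2 le_rfl)⟩
  | zero => exact .inl rfl
  | add x y _ _ hx hy =>
    rcases hx with rfl | ⟨d₁, h₁, hx⟩
    · simpa using hy
    rcases hy with rfl | ⟨d₂, h₂, hy⟩
    · exact .inr ⟨d₁, h₁, by simpa using hx⟩
    · exact .inr ⟨d₁ ⊔ d₂, max_lt h₁ h₂, add_mem
        (repSpan_mono subset_rfl (Set.Iic_subset_Iic.2 le_sup_left) hx)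
        (repSpan_mono subset_rfl (Set.Iic_subset_Iic.2 le_sup_right) hy)⟩
  | smul a x _ hx =>
    rcases hx with rfl | ⟨d₁, h₁, hx⟩
    · simp
    · exact .inr ⟨d₁, h₁, Submodule.smul_mem _ _ hx⟩

lemma exists_mem_repSpan_of_mem_span {G : Set (MvPolynomial σ A)} {x : MvPolynomial σ A}
    (hx : x ∈ Ideal.span G) : ∃ d, x ∈ repSpan m G (Set.Iic d) := by
  have mono {d d' : m.syn} (h : d ≤ d') := repSpan_mono (subset_refl G) (Set.Iic_subset_Iic.2 h)
  induction hx using Submodule.span_induction with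
  | mem x hx => exact ⟨_, mem_repSpan_self hx (Set.mem_Iic.2 le_rfl)⟩
  | zero => exact ⟨0, zero_mem _⟩
  | add x y _ _ hx hy =>
    obtain ⟨d₁, hx⟩ := hx
    obtain ⟨d₂, hy⟩ := hy
    exact ⟨d₁ ⊔ d₂, add_mem (mono le_sup_left hx) (mono le_sup_right hy)⟩
  | smul a x _ hx =>
    obtain ⟨d, hx⟩ := hx
    induction a using MvPolynomial.induction_on' with
    | monomial s c =>
      refine ⟨m.toSyn s + d, monomial_mul_repSpan c (fun e he => ?_) hx⟩
      exact Set.mem_Iic.2 (by gcongr; exact he)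
    | add p q hp hq =>
      obtain ⟨d₁, hp⟩ := hp
      obtain ⟨d₂, hq⟩ := hq
      rw [add_smul]
      exact ⟨d₁ ⊔ d₂, add_mem (mono le_sup_left hp) (mono le_sup_right hq)⟩

end Representations

/-! ### Buchberger's criterion over a ring with zero divisors -/

section Criterion

variable {σ A : Type*} [CommRing A] {m : MonomialOrder σ}

/-- Modulo lower terms, a multiple of `h` is a multiple of any `g` whose lead term divides it. -/
lemma exists_sub_mem_repSpan {G : Set (MvPolynomial σ A)}
    (hA : ∀ g ∈ G, ∀ a, a * m.leadingCoeff g = 0 →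
      C a * g ∈ repSpan m G (Set.Iio (m.toSyn (m.degree g))))
    {g h s : MvPolynomial σ A} (hh : h ∈ G) (hs : IsSPoly m g h s)
    (hs' : s ∈ repSpan m G (Set.Iio (m.toSyn (m.degree g ⊔ m.degree h))))
    (hdvd : m.leadingCoeff g ∣ m.leadingCoeff h) {d : σ →₀ ℕ} (hgd : m.degree g ≤ d)
    (hhd : m.degree h ≤ d) (c : A) :
    ∃ c', monomial (d - m.degree h) c * h - monomial (d - m.degree g) c' * g ∈
      repSpan m G (Set.Iio (m.toSyn d)) := by
  obtain ⟨a, af, ag, hspan, haf, hag, rfl⟩ := hs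
  rw [inf_eq_right.2 (Ideal.span_singleton_le_span_singleton.2 hdvd)] at hspan
  obtain ⟨w, hw⟩ := Ideal.span_singleton_le_span_singleton.1 hspan.ge
  set t := m.degree g ⊔ m.degree h with ht
  have htd : t ≤ d := sup_le hgd hhd
  -- `w * ag` is 1 only up to the annihilator of the lead coefficient of `h`. So `c * h` splits into
  -- a part with factor `1 - w * ag`, lowered by `hA`, and a part with factor `w * ag`, which the
  -- S-polynomial trades for a multiple of `g`.
  have hann : (1 - w * ag) * m.leadingCoeff h = 0 := by
    rw [sub_mul, mul_assoc, hag, hw]; ring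
  have h₁ := monomial_mul_repSpan (s := d - m.degree h) (D' := Set.Iio (m.toSyn d)) c (by
    intro e he
    rw [Set.mem_Iio] at he ⊢
    calc m.toSyn (d - m.degree h) + e < m.toSyn (d - m.degree h) + m.toSyn (m.degree h) := by
          gcongr
      _ = m.toSyn d := by rw [← map_add, tsub_add_cancel_of_le hhd]) (hA h hh _ hann)
  have h₂ := monomial_mul_repSpan (s := d - t) (D' := Set.Iio (m.toSyn d)) (c * w) (by
    intro e he
    rw [Set.mem_Iio] at he ⊢
    calc m.toSyn (d - t) + e < m.toSyn (d - t) + m.toSyn t := by gcongr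
      _ = m.toSyn d := by rw [← map_add, tsub_add_cancel_of_le htd]) hs'
  refine ⟨c * w * af, ?_⟩
  convert sub_mem h₁ h₂ using 1
  have e₁ : (d - t) + (t - m.degree g) = d - m.degree g := tsub_add_tsub_cancel htd le_sup_left
  have e₂ : (d - t) + (t - m.degree h) = d - m.degree h := tsub_add_tsub_cancel htd le_sup_right
  rw [mul_sub, ← mul_assoc, ← mul_assoc, ← mul_assoc, monomial_mul, monomial_mul, e₁, e₂,
    mul_comm (monomial _ c) (C _), C_mul_monomial, sub_mul, one_mul, map_sub, sub_mul]
  rw [show c * w * ag = w * ag * c by ring]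
  ring

/-- Among finitely many elements of `G` below `d` there is one whose lead coefficient divides the
others, if `G` has enough GCD-polynomials. -/
lemma exists_dvd_leadingCoeff {G : Finset (MvPolynomial σ A)}
    (hD : ∀ g ∈ G, ∀ h ∈ G, ∃ k ∈ G, m.degree k ≤ m.degree g ⊔ m.degree h ∧
      m.leadingCoeff k ∣ m.leadingCoeff g ∧ m.leadingCoeff k ∣ m.leadingCoeff h)
    (d : σ →₀ ℕ) {g₀ : MvPolynomial σ A} (hg₀ : g₀ ∈ G) (hd₀ : m.degree g₀ ≤ d) :
    ∃ k ∈ G, m.degree k ≤ d ∧ ∀ g ∈ G, m.degree g ≤ d → m.leadingCoeff k ∣ m.leadingCoeff g := by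
  classical
  -- The divisor `k` is sought in `G` and not in `T`, since the elements provided by `hD` may leave
  -- `T`.
  suffices H : ∀ T : Finset (MvPolynomial σ A), T ⊆ G → ∃ k ∈ G, m.degree k ≤ d ∧
      ∀ g ∈ T, m.degree g ≤ d → m.leadingCoeff k ∣ m.leadingCoeff g from H G subset_rfl
  intro T
  induction T using Finset.induction_on with
  | empty => exact fun _ => ⟨g₀, hg₀, hd₀, by simp⟩
  | insert g T _ ih =>
    intro hT
    rw [Finset.insert_subset_iff] at hT
    obtain ⟨k, hk, hkd, hkT⟩ := ih hT.2
    by_cases hgd : m.degree g ≤ d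
    · obtain ⟨k', hk', hk'd, h₁, h₂⟩ := hD g hT.1 k hk
      refine ⟨k', hk', hk'd.trans (sup_le hgd hkd), fun x hx hxd => ?_⟩
      rcases Finset.mem_insert.1 hx with rfl | hx
      · exact h₁
      · exact h₂.trans (hkT x hx hxd)
    · refine ⟨k, hk, hkd, fun x hx hxd => ?_⟩
      rcases Finset.mem_insert.1 hx with rfl | hx
      · exact absurd hxd hgd
      · exact hkT x hx hxd

/-- Buchberger's criterion for strong Gröbner bases. -/
theorem exists_topReduces_of_mem_span {G : Finset (MvPolynomial σ A)}
    (hS : ∀ g ∈ G, ∀ h ∈ G, g ≠ h → ∃ s, IsSPoly m g h s ∧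
      s ∈ repSpan m G (Set.Iio (m.toSyn (m.degree g ⊔ m.degree h))))
    (hA : ∀ g ∈ G, ∀ a, a * m.leadingCoeff g = 0 →
      C a * g ∈ repSpan m G (Set.Iio (m.toSyn (m.degree g))))
    (hD : ∀ g ∈ G, ∀ h ∈ G, ∃ k ∈ G, m.degree k ≤ m.degree g ⊔ m.degree h ∧
      m.leadingCoeff k ∣ m.leadingCoeff g ∧ m.leadingCoeff k ∣ m.leadingCoeff h)
    {x : MvPolynomial σ A} (hx : x ∈ Ideal.span (G : Set (MvPolynomial σ A))) (hx0 : x ≠ 0) :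
    ∃ g ∈ G, TopReduces m g x := by
  obtain ⟨d, hd⟩ := exists_mem_repSpan_of_mem_span (m := m) hx
  clear hx
  induction d using WellFoundedLT.induction with
  | _ d ih =>
  obtain ⟨d, rfl⟩ := m.toSyn.surjective d
  have step (h : x ∈ repSpan m (G : Set _) (Set.Iio (m.toSyn d))) : ∃ g ∈ G, TopReduces m g x := by
    rcases repSpan_Iio h with rfl | ⟨d', hd', h⟩
    · exact absurd rfl hx0
    · exact ih d' hd' h
  by_cases hne : ∃ g₀ ∈ G, m.degree g₀ ≤ d
  · obtain ⟨g₀, hg₀, hd₀⟩ := hne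
    obtain ⟨k, hk, hkd, hkG⟩ := exists_dvd_leadingCoeff hD d hg₀ hd₀
    -- Modulo terms below `d`, all summands at `d` collapse to a single multiple of `k`.
    have key : ∃ c, x - monomial (d - m.degree k) c * k ∈
        repSpan m (G : Set _) (Set.Iio (m.toSyn d)) := by
      clear ih step hx0
      induction hd using Submodule.span_induction with
      | mem x hx =>
        obtain ⟨g, hg, s, c, hs, rfl⟩ := hx
        rcases (Set.mem_Iic.1 hs).lt_or_eq with hs | hs
        · exact ⟨0, by simpa using monomial_mul_mem_repSpan hg c hs⟩
        have hs := m.toSyn.injective hs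
        obtain rfl : s = d - m.degree g := by rw [← hs, add_tsub_cancel_right]
        have hgd : m.degree g ≤ d := hs ▸ le_add_self
        by_cases hkg : k = g
        · subst hkg
          exact ⟨c, by simp⟩
        obtain ⟨S, hS, hS'⟩ := hS k hk g hg hkg
        exact exists_sub_mem_repSpan hA hg hS hS' (hkG g hg hgd) hkd hgd c
      | zero => exact ⟨0, by simp⟩
      | add x y _ _ hx hy =>
        obtain ⟨c₁, hx⟩ := hx
        obtain ⟨c₂, hy⟩ := hy
        refine ⟨c₁ + c₂, ?_⟩
        convert add_mem hx hy using 1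
        rw [map_add]; ring
      | smul a x _ hx =>
        obtain ⟨c, hx⟩ := hx
        refine ⟨a * c, ?_⟩
        convert Submodule.smul_mem _ a hx using 1
        rw [smul_sub, ← smul_mul_assoc, smul_monomial, smul_eq_mul]
    obtain ⟨c, hc⟩ := key
    have hxe : x = (x - monomial (d - m.degree k) c * k) + monomial (d - m.degree k) c * k := by
      ring
    have hdk : d - m.degree k + m.degree k = d := tsub_add_cancel_of_le hkd
    -- If this product vanishes, the multiple of `k` drops below `d` by `hA`; otherwise it is the
    -- lead coefficient of `x`, at exponent `d`.
    by_cases hck : c * m.leadingCoeff k = 0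
    · refine step ?_
      rw [hxe]
      refine add_mem hc ?_
      have := monomial_mul_repSpan (s := d - m.degree k) (D' := Set.Iio (m.toSyn d)) 1 (by
        intro e he
        rw [Set.mem_Iio] at he ⊢
        calc m.toSyn (d - m.degree k) + e < m.toSyn (d - m.degree k) + m.toSyn (m.degree k) := by
              gcongr
          _ = m.toSyn d := by rw [← map_add, hdk]) (hA k hk c hck)
      rwa [← mul_assoc, mul_comm (monomial _ _) (C _), C_mul_monomial, mul_one] at this
    · have hcoeff : x.coeff d = c * m.leadingCoeff k := by
        rw [hxe, coeff_add, coeff_eq_zero_of_mem_repSpan (fun e he => he) hc, zero_add]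
        conv_lhs => rw [← hdk]
        rw [add_tsub_cancel_right]
        exact coeff_monomial_mul_degree m _ _ _
      have hle : m.degree x ≼[m] d := by
        refine m.degree_le_iff.2 fun e he => ?_
        by_contra! hlt
        exact mem_support_iff.1 he
          (coeff_eq_zero_of_mem_repSpan (fun e' he' => lt_of_le_of_lt he' hlt) hd)
      have hdeg := degree_eq_of_coeff_ne_zero m hle (hcoeff ▸ hck)
      refine ⟨k, hk, hdeg ▸ hkd, ?_⟩
      rw [MonomialOrder.leadingCoeff, MonomialOrder.leadingCoeff, hdeg, hcoeff]
      exact dvd_mul_left _ _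
  -- No element of `G` has degree dividing `d`, so no summand sits exactly at `d`.
  · refine step ?_
    suffices H : repSpan m (G : Set (MvPolynomial σ A)) (Set.Iic (m.toSyn d)) ≤
        repSpan m (G : Set (MvPolynomial σ A)) (Set.Iio (m.toSyn d)) from H hd
    refine Submodule.span_le.2 ?_
    rintro _ ⟨g, hg, s, c, hs, rfl⟩
    refine monomial_mul_mem_repSpan hg c (lt_of_le_of_ne hs fun h => hne ⟨g, hg, ?_⟩)
    rw [← m.toSyn.injective h]
    exact le_add_self

end Criterion

/-! ### Strong Gröbner bases in terms of top-reduction -/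

section Strong

variable {σ A : Type*} [CommRing A] {m : MonomialOrder σ}

lemma TopReduces.leadingTerm_dvd {g f : MvPolynomial σ A} (h : TopReduces m g f) :
    m.leadingTerm g ∣ m.leadingTerm f :=
  monomial_dvd_monomial.2 ⟨.inr h.1, h.2⟩

lemma topReduces_of_leadingTerm_dvd {g f : MvPolynomial σ A} (hf : f ≠ 0)
    (h : m.leadingTerm g ∣ m.leadingTerm f) : TopReduces m g f := by
  obtain ⟨h₁, h₂⟩ := monomial_dvd_monomial.1 h
  exact ⟨h₁.resolve_left (m.leadingCoeff_ne_zero_iff.2 hf), h₂⟩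

lemma isStrongGroebnerBasis_of_topReduces {G : Finset (MvPolynomial σ A)}
    {I : Ideal (MvPolynomial σ A)} (hG : (G : Set (MvPolynomial σ A)) ⊆ I)
    (h : ∀ f ∈ I, f ≠ 0 → ∃ g ∈ G, TopReduces m g f) : IsStrongGroebnerBasis m G I := by
  have hdvd : ∀ f ∈ I, f ≠ 0 → ∃ g ∈ G, m.leadingTerm g ∣ m.leadingTerm f := fun f hf hf0 =>
    let ⟨g, hg, hr⟩ := h f hf hf0
    ⟨g, hg, hr.leadingTerm_dvd⟩
  refine ⟨⟨hG, le_antisymm (Ideal.span_mono (Set.image_mono hG)) (Ideal.span_le.2 ?_)⟩, hdvd⟩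
  rintro _ ⟨f, hf, rfl⟩
  by_cases hf0 : f = 0
  · simp [hf0]
  · obtain ⟨g, hg, hr⟩ := hdvd f hf hf0
    exact Ideal.mem_of_dvd _ hr (Ideal.subset_span ⟨g, hg, rfl⟩)

lemma IsStrongGroebnerBasis.exists_topReduces {G : Finset (MvPolynomial σ A)}
    {I : Ideal (MvPolynomial σ A)} (h : IsStrongGroebnerBasis m G I) {f : MvPolynomial σ A}
    (hf : f ∈ I) (hf0 : f ≠ 0) : ∃ g ∈ G, TopReduces m g f :=
  let ⟨g, hg, hr⟩ := h.2 f hf hf0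
  ⟨g, hg, topReduces_of_leadingTerm_dvd hf0 hr⟩

end Strong

/-! ### Lead terms of critical polynomials and of top-reductions -/

section CriticalPolynomials

variable {σ A : Type*} [CommRing A] {m : MonomialOrder σ} {f g h s : MvPolynomial σ A}

/-- Needed because the algorithm forms one S-polynomial per unordered pair, while the criterion asks
for both orders. -/
lemma IsSPoly.symm (hs : IsSPoly m f g s) : IsSPoly m g f (-s) := by
  obtain ⟨a, af, ag, h₁, h₂, h₃, rfl⟩ := hs
  refine ⟨a, ag, af, by rw [h₁, inf_comm], h₃, h₂, ?_⟩
  rw [sup_comm (m.degree g)]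
  ring

lemma IsSPoly.mem {I : Ideal (MvPolynomial σ A)} (hs : IsSPoly m f g s) (hf : f ∈ I) (hg : g ∈ I) :
    s ∈ I := by
  obtain ⟨a, af, ag, _, _, _, rfl⟩ := hs
  exact sub_mem (I.mul_mem_left _ hf) (I.mul_mem_left _ hg)

lemma IsGCDPoly.mem {I : Ideal (MvPolynomial σ A)} (hs : IsGCDPoly m f g s) (hf : f ∈ I)
    (hg : g ∈ I) : s ∈ I := by
  obtain ⟨b, bf, bg, _, _, rfl⟩ := hs
  exact add_mem (I.mul_mem_left _ hf) (I.mul_mem_left _ hg)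

lemma IsAnnPoly.mem {I : Ideal (MvPolynomial σ A)} (hs : IsAnnPoly m f s) (hf : f ∈ I) : s ∈ I := by
  obtain ⟨a, _, rfl⟩ := hs
  exact I.mul_mem_left _ hf

lemma degree_monomial_sub_mul_le {d : σ →₀ ℕ} (hd : m.degree f ≤ d) (c : A) :
    m.degree (monomial (d - m.degree f) c * f) ≼[m] d := by
  simpa [tsub_add_cancel_of_le hd] using degree_monomial_mul_le m (d - m.degree f) c f

lemma coeff_monomial_sub_mul {d : σ →₀ ℕ} (hd : m.degree f ≤ d) (c : A) :
    (monomial (d - m.degree f) c * f).coeff d = c * m.leadingCoeff f := by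
  simpa [tsub_add_cancel_of_le hd] using coeff_monomial_mul_degree m (d - m.degree f) c f

/-- The two contributions at the common multiple cancel. Zero is a separate case because its degree
is 0 by convention, which is not below the degree 0 of constants. -/
lemma IsSPoly.eq_zero_or_degree_lt (hs : IsSPoly m f g s) :
    s = 0 ∨ m.degree s ≺[m] m.degree f ⊔ m.degree g := by
  obtain ⟨a, af, ag, _, hf, hg, rfl⟩ := hs
  refine SplitGB.eq_zero_or_degree_lt m (m.degree_sub_le.trans (sup_le ?_ ?_)) ?_
  · exact degree_monomial_sub_mul_le le_sup_left _
  · exact degree_monomial_sub_mul_le le_sup_right _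
  · rw [coeff_sub, coeff_monomial_sub_mul le_sup_left, coeff_monomial_sub_mul le_sup_right, hf, hg,
      sub_self]

lemma IsAnnPoly.eq_zero_or_degree_lt (hs : IsAnnPoly m f s) :
    s = 0 ∨ m.degree s ≺[m] m.degree f := by
  obtain ⟨a, ha, rfl⟩ := hs
  have ha : a ∈ (Ideal.span {m.leadingCoeff f}).annihilator := ha ▸ Ideal.mem_span_singleton_self a
  rw [C_mul']
  refine SplitGB.eq_zero_or_degree_lt m m.degree_smul_le ?_
  rw [coeff_smul]
  exact (Submodule.mem_annihilator_span_singleton _ _).1 ha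

/-- A GCD-polynomial has the expected lead term. -/
lemma IsGCDPoly.lead (hs : IsGCDPoly m f g s) (hf : f ≠ 0) :
    s ≠ 0 ∧ m.degree s = m.degree f ⊔ m.degree g ∧
      m.leadingCoeff s ∣ m.leadingCoeff f ∧ m.leadingCoeff s ∣ m.leadingCoeff g := by
  obtain ⟨b, bf, bg, hspan, hb, rfl⟩ := hs
  have hbf : b ∣ m.leadingCoeff f :=
    Ideal.span_singleton_le_span_singleton.1 (hspan ▸ le_sup_left)
  have hbg : b ∣ m.leadingCoeff g :=
    Ideal.span_singleton_le_span_singleton.1 (hspan ▸ le_sup_right)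
  have hb0 : b ≠ 0 := by
    rintro rfl
    exact m.leadingCoeff_ne_zero_iff.2 hf (zero_dvd_iff.1 hbf)
  set s := monomial (m.degree f ⊔ m.degree g - m.degree f) bf * f
      + monomial (m.degree f ⊔ m.degree g - m.degree g) bg * g
  have hc : s.coeff (m.degree f ⊔ m.degree g) = b := by
    rw [coeff_add, coeff_monomial_sub_mul le_sup_left, coeff_monomial_sub_mul le_sup_right, hb]
  have hdeg : m.degree s = m.degree f ⊔ m.degree g := by
    refine degree_eq_of_coeff_ne_zero m (m.degree_add_le.trans (sup_le ?_ ?_)) (hc ▸ hb0)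
    · exact degree_monomial_sub_mul_le le_sup_left _
    · exact degree_monomial_sub_mul_le le_sup_right _
  have hlc : m.leadingCoeff s = b := by rw [MonomialOrder.leadingCoeff, hdeg, hc]
  exact ⟨fun h0 => hb0 (by rw [← hlc, h0, m.leadingCoeff_zero]), hdeg, hlc ▸ hbf, hlc ▸ hbg⟩

lemma TopReduces.exists_isTopReduction (h : TopReduces m g f) : ∃ f', IsTopReduction m g f f' := by
  obtain ⟨h₁, c, hc⟩ := h
  exact ⟨_, h₁, c, by rw [hc, mul_comm], rfl⟩

lemma IsTopReduction.topReduces (h : IsTopReduction m g f s) : TopReduces m g f := by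
  obtain ⟨h₁, c, hc, _⟩ := h
  exact ⟨h₁, c, by rw [← hc, mul_comm]⟩

lemma IsTopReduction.mem {I : Ideal (MvPolynomial σ A)} (h : IsTopReduction m g f s) (hf : f ∈ I)
    (hg : g ∈ I) : s ∈ I := by
  obtain ⟨_, c, _, rfl⟩ := h
  exact sub_mem hf (I.mul_mem_left _ hg)

lemma IsTopReduction.eq_zero_or_degree_lt (h : IsTopReduction m g f s) :
    s = 0 ∨ m.degree s ≺[m] m.degree f := by
  obtain ⟨h₁, c, hc, rfl⟩ := h
  refine SplitGB.eq_zero_or_degree_lt m (m.degree_sub_le.trans (sup_le le_rfl ?_)) ?_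
  · exact degree_monomial_sub_mul_le h₁ _
  · rw [coeff_sub, coeff_monomial_sub_mul h₁, hc]
    exact sub_self _

lemma IsTopReduction.degree_le (h : IsTopReduction m g f s) : m.degree s ≼[m] m.degree f := by
  rcases h.eq_zero_or_degree_lt with rfl | h
  · simp
  · exact h.le

lemma IsTopReduction.sub_mem_repSpan {G : Set (MvPolynomial σ A)} (h : IsTopReduction m g f s)
    (hg : g ∈ G) : f - s ∈ repSpan m G (Set.Iic (m.toSyn (m.degree f))) := by
  obtain ⟨h₁, c, hc, rfl⟩ := h
  rw [sub_sub_cancel]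
  exact monomial_mul_mem_repSpan hg c (by rw [tsub_add_cancel_of_le h₁]; exact Set.mem_Iic.2 le_rfl)

end CriticalPolynomials

/-! ### Existence of critical polynomials over principal ideal rings -/

section Existence

lemma exists_isInitialBasis {σ A : Type*} [CommRing A] {k : ℕ} (F : Fin k → MvPolynomial σ A) : ∃ G, IsInitialBasis F G := by
  classical
  refine ⟨(Finset.univ.image F).erase 0, fun g => ?_⟩
  simp [eq_comm]

variable {σ A : Type*} [CommRing A] [IsPrincipalIdealRing A] (m : MonomialOrder σ)

lemma exists_isSPoly (f g : MvPolynomial σ A) : ∃ s, IsSPoly m f g s := by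
  obtain ⟨a, ha⟩ := (IsPrincipalIdealRing.principal
    (Ideal.span {m.leadingCoeff f} ⊓ Ideal.span {m.leadingCoeff g})).principal
  have hmem : a ∈ Ideal.span {m.leadingCoeff f} ⊓ Ideal.span {m.leadingCoeff g} := by
    rw [ha]; exact Submodule.mem_span_singleton_self a
  obtain ⟨af, hf⟩ := Ideal.mem_span_singleton'.1 hmem.1
  obtain ⟨ag, hg⟩ := Ideal.mem_span_singleton'.1 hmem.2
  exact ⟨_, a, af, ag, ha.symm, hf, hg, rfl⟩

lemma exists_isGCDPoly (f g : MvPolynomial σ A) : ∃ s, IsGCDPoly m f g s := by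
  obtain ⟨b, hb⟩ := (IsPrincipalIdealRing.principal
    (Ideal.span {m.leadingCoeff f} ⊔ Ideal.span {m.leadingCoeff g})).principal
  have hmem : b ∈ Ideal.span {m.leadingCoeff f} ⊔ Ideal.span {m.leadingCoeff g} := by
    rw [hb]; exact Submodule.mem_span_singleton_self b
  obtain ⟨x, hx, y, hy, hxy⟩ := Submodule.mem_sup.1 hmem
  obtain ⟨bf, rfl⟩ := Ideal.mem_span_singleton'.1 hx
  obtain ⟨bg, rfl⟩ := Ideal.mem_span_singleton'.1 hy
  exact ⟨_, b, bf, bg, hb.symm, hxy.symm, rfl⟩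

lemma exists_isAnnPoly (f : MvPolynomial σ A) : ∃ s, IsAnnPoly m f s := by
  obtain ⟨a, ha⟩ := (IsPrincipalIdealRing.principal
    (Ideal.span {m.leadingCoeff f}).annihilator).principal
  exact ⟨_, a, ha.symm, rfl⟩

lemma exists_isInitialPairSet (all : Prop) {k : ℕ} (F : Fin k → MvPolynomial σ A) :
    ∃ P, IsInitialPairSet m all F P := by
  choose S hS using fun i j => exists_isSPoly m (F i) (F j)
  choose T hT using fun i j => exists_isGCDPoly m (F i) (F j)
  choose U hU using fun i => exists_isAnnPoly m (F i)
  have hfin : {h | (∃ i j, i < j ∧ F i ≠ 0 ∧ F j ≠ 0 ∧ (h = S i j ∨ (all ∧ h = T i j))) ∨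
      (all ∧ ∃ i, F i ≠ 0 ∧ h = U i)}.Finite := by
    refine (((Set.finite_range fun p : Fin k × Fin k => S p.1 p.2).union
      (Set.finite_range fun p : Fin k × Fin k => T p.1 p.2)).union (Set.finite_range U)).subset ?_
    rintro h (⟨i, j, _, _, _, rfl | ⟨_, rfl⟩⟩ | ⟨_, i, _, rfl⟩)
    · exact .inl (.inl ⟨(i, j), rfl⟩)
    · exact .inl (.inr ⟨(i, j), rfl⟩)
    · exact .inr ⟨i, rfl⟩
  exact ⟨hfin.toFinset, S, T, U, fun i j _ _ => ⟨hS i j, hT i j⟩, fun i _ => hU i, fun h => by simp⟩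

lemma exists_isNewPairSet (all : Prop) (G : Finset (MvPolynomial σ A)) (h : MvPolynomial σ A) :
    ∃ Q, IsNewPairSet m all G h Q := by
  choose S hS using fun g => exists_isSPoly m g h
  choose T hT using fun g => exists_isGCDPoly m g h
  obtain ⟨U, hU⟩ := exists_isAnnPoly m h
  have hfin : {x | (∃ g ∈ G, x = S g ∨ (all ∧ x = T g)) ∨ (all ∧ x = U)}.Finite := by
    refine (((G.finite_toSet.image S).union (G.finite_toSet.image T)).union
      (Set.finite_singleton U)).subset ?_
    rintro x (⟨g, hg, rfl | ⟨_, rfl⟩⟩ | ⟨_, rfl⟩)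
    · exact .inl (.inl ⟨g, hg, rfl⟩)
    · exact .inl (.inr ⟨g, hg, rfl⟩)
    · exact .inr rfl
  exact ⟨hfin.toFinset, S, T, U, fun g _ => ⟨hS g, hT g⟩, hU, fun x => by simp⟩

end Existence

/-! ### Reduction to a remainder, and bases whose critical polynomials reduce to zero -/

section Invariant

variable {σ A : Type*} [CommRing A] {m : MonomialOrder σ}

variable (m) in
/-- The remainder `h` has been obtained from `x` by top-reductions by elements of `G`. -/
def ReducesTo (G : Set (MvPolynomial σ A)) (h x : MvPolynomial σ A) : Prop :=
  x - h ∈ repSpan m G (Set.Iic (m.toSyn (m.degree x))) ∧ m.degree h ≼[m] m.degree x ∧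
    (x = h ∨ ∃ g ∈ G, TopReduces m g x)

lemma ReducesTo.refl (G : Set (MvPolynomial σ A)) (h : MvPolynomial σ A) : ReducesTo m G h h :=
  ⟨by simp, le_rfl, .inl rfl⟩

lemma ReducesTo.mono {G G' : Set (MvPolynomial σ A)} (hG : G ⊆ G') {h x : MvPolynomial σ A}
    (hx : ReducesTo m G h x) : ReducesTo m G' h x :=
  ⟨repSpan_mono hG subset_rfl hx.1, hx.2.1, hx.2.2.imp_right fun ⟨g, hg, hr⟩ => ⟨g, hG hg, hr⟩⟩

/-- The subtracted term has degree at most that of `h`, hence of `x`. The first reduction records a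
top-reducer of `x` itself, and later ones keep it. -/
lemma ReducesTo.step {G : Set (MvPolynomial σ A)} {g h h' x : MvPolynomial σ A}
    (hx : ReducesTo m G h x) (hg : g ∈ G) (hr : IsTopReduction m g h h') : ReducesTo m G h' x := by
  refine ⟨?_, hr.degree_le.trans hx.2.1, .inr ?_⟩
  · rw [← sub_add_sub_cancel x h h']
    exact add_mem hx.1
      (repSpan_mono subset_rfl (Set.Iic_subset_Iic.2 hx.2.1) (hr.sub_mem_repSpan hg))
  · rcases hx.2.2 with rfl | h
    · exact ⟨g, hg, hr.topReduces⟩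
    · exact h

/-- Once `h` is in the basis, the remainder `h` can itself be subtracted. If no reduction took
place, then `x = h` is its own top-reducer. -/
lemma ReducesTo.insert {G : Set (MvPolynomial σ A)} {h x : MvPolynomial σ A}
    (hx : ReducesTo m G h x) : ReducesTo m (insert h G) 0 x := by
  refine ⟨?_, by simp, .inr ?_⟩
  · rw [sub_zero, ← sub_add_cancel x h]
    refine add_mem (repSpan_mono (Set.subset_insert _ _) ?_ hx.1)
      (mem_repSpan_self (Set.mem_insert _ _) ?_)
    · simp
    · simpa using hx.2.1
  · rcases hx.2.2 with rfl | ⟨g, hg, hr⟩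
    · exact ⟨x, Set.mem_insert _ _, le_rfl, dvd_rfl⟩
    · exact ⟨g, Set.mem_insert_of_mem _ hg, hr⟩

lemma ReducesTo.mem_repSpan_Iio {G : Set (MvPolynomial σ A)} {x : MvPolynomial σ A} {d : m.syn}
    (hx : ReducesTo m G 0 x) (hd : x = 0 ∨ m.toSyn (m.degree x) < d) :
    x ∈ repSpan m G (Set.Iio d) := by
  rcases hd with rfl | hd
  · exact zero_mem _
  · exact repSpan_mono subset_rfl (Set.Iic_subset_Iio.2 hd) (by simpa using hx.1)

variable (m) in
/-- `T` holds an S-polynomial of each pair of elements of `G` and, if `all` holds, also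
GCD-polynomials and annihilator polynomials. -/
structure Covers (all : Prop) (G : Finset (MvPolynomial σ A)) (T : Set (MvPolynomial σ A)) :
    Prop where
  sPoly : ∀ g ∈ G, ∀ h ∈ G, g ≠ h → ∃ s ∈ T, IsSPoly m g h s ∨ IsSPoly m h g s
  gcdPoly : all → ∀ g ∈ G, ∀ h ∈ G, g ≠ h → ∃ s ∈ T, IsGCDPoly m g h s ∨ IsGCDPoly m h g s
  annPoly : all → ∀ g ∈ G, ∃ s ∈ T, IsAnnPoly m g s

lemma Covers.mono {all : Prop} {G : Finset (MvPolynomial σ A)} {T T' : Set (MvPolynomial σ A)}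
    (h : Covers m all G T) (hT : T ⊆ T') : Covers m all G T' where
  sPoly g hg h' hh' hne := let ⟨s, hs, H⟩ := h.sPoly g hg h' hh' hne; ⟨s, hT hs, H⟩
  gcdPoly ha g hg h' hh' hne := let ⟨s, hs, H⟩ := h.gcdPoly ha g hg h' hh' hne; ⟨s, hT hs, H⟩
  annPoly ha g hg := let ⟨s, hs, H⟩ := h.annPoly ha g hg; ⟨s, hT hs, H⟩

lemma IsInitialPairSet.covers {all : Prop} {k : ℕ} {F : Fin k → MvPolynomial σ A}
    {G P : Finset (MvPolynomial σ A)} (hG : IsInitialBasis F G) (hP : IsInitialPairSet m all F P) :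
    Covers m all G P := by
  obtain ⟨S, T, U, hST, hU, hP⟩ := hP
  refine ⟨fun g hg h hh hne => ?_, fun ha g hg h hh hne => ?_, fun ha g hg => ?_⟩
  · obtain ⟨hi, i, rfl⟩ := (hG g).1 hg
    obtain ⟨hj, j, rfl⟩ := (hG h).1 hh
    rcases lt_trichotomy i j with hij | rfl | hij
    · exact ⟨_, (hP _).2 (.inl ⟨i, j, hij, hi, hj, .inl rfl⟩), .inl (hST i j hi hj).1⟩
    · exact absurd rfl hne
    · exact ⟨_, (hP _).2 (.inl ⟨j, i, hij, hj, hi, .inl rfl⟩), .inr (hST j i hj hi).1⟩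
  · obtain ⟨hi, i, rfl⟩ := (hG g).1 hg
    obtain ⟨hj, j, rfl⟩ := (hG h).1 hh
    rcases lt_trichotomy i j with hij | rfl | hij
    · exact ⟨_, (hP _).2 (.inl ⟨i, j, hij, hi, hj, .inr ⟨ha, rfl⟩⟩), .inl (hST i j hi hj).2⟩
    · exact absurd rfl hne
    · exact ⟨_, (hP _).2 (.inl ⟨j, i, hij, hj, hi, .inr ⟨ha, rfl⟩⟩), .inr (hST j i hj hi).2⟩
  · obtain ⟨hi, i, rfl⟩ := (hG g).1 hg
    exact ⟨_, (hP _).2 (.inr ⟨ha, i, hi, rfl⟩), hU i hi⟩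

lemma IsInitialPairSet.subset {all : Prop} {k : ℕ} {F : Fin k → MvPolynomial σ A}
    {P : Finset (MvPolynomial σ A)} {I : Ideal (MvPolynomial σ A)} (hF : ∀ i, F i ∈ I)
    (hP : IsInitialPairSet m all F P) : ∀ x ∈ P, x ∈ I := by
  obtain ⟨S, T, U, hST, hU, hP⟩ := hP
  intro x hx
  rcases (hP x).1 hx with ⟨i, j, _, hi, hj, rfl | ⟨_, rfl⟩⟩ | ⟨_, i, hi, rfl⟩
  · exact (hST i j hi hj).1.mem (hF i) (hF j)
  · exact (hST i j hi hj).2.mem (hF i) (hF j)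
  · exact (hU i hi).mem (hF i)

lemma IsNewPairSet.subset {all : Prop} {G Q : Finset (MvPolynomial σ A)} {h : MvPolynomial σ A}
    {I : Ideal (MvPolynomial σ A)} (hG : ∀ g ∈ G, g ∈ I) (hh : h ∈ I)
    (hQ : IsNewPairSet m all G h Q) : ∀ x ∈ Q, x ∈ I := by
  obtain ⟨S, T, U, hST, hU, hQ⟩ := hQ
  intro x hx
  rcases (hQ x).1 hx with ⟨g, hg, rfl | ⟨_, rfl⟩⟩ | ⟨_, rfl⟩
  · exact (hST g hg).1.mem (hG g hg) hh
  · exact (hST g hg).2.mem (hG g hg) hh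
  · exact hU.mem hh

lemma Covers.insert [DecidableEq (MvPolynomial σ A)] {all : Prop} {G Q : Finset (MvPolynomial σ A)}
    {T : Set (MvPolynomial σ A)} {h : MvPolynomial σ A} (hc : Covers m all G T)
    (hQ : IsNewPairSet m all G h Q) : Covers m all (insert h G) (T ∪ Q) := by
  obtain ⟨S, T', U, hST, hU, hQ⟩ := hQ
  refine ⟨fun g hg g' hg' hne => ?_, fun ha g hg g' hg' hne => ?_, fun ha g hg => ?_⟩
  · rcases Finset.mem_insert.1 hg with rfl | hg₁ <;>
      rcases Finset.mem_insert.1 hg' with rfl | hg₂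
    · exact absurd rfl hne
    · exact ⟨_, .inr ((hQ _).2 (.inl ⟨g', hg₂, .inl rfl⟩)), .inr (hST g' hg₂).1⟩
    · exact ⟨_, .inr ((hQ _).2 (.inl ⟨g, hg₁, .inl rfl⟩)), .inl (hST g hg₁).1⟩
    · obtain ⟨s, hs, H⟩ := hc.sPoly g hg₁ g' hg₂ hne
      exact ⟨s, .inl hs, H⟩
  · rcases Finset.mem_insert.1 hg with rfl | hg₁ <;>
      rcases Finset.mem_insert.1 hg' with rfl | hg₂
    · exact absurd rfl hne
    · exact ⟨_, .inr ((hQ _).2 (.inl ⟨g', hg₂, .inr ⟨ha, rfl⟩⟩)), .inr (hST g' hg₂).2⟩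
    · exact ⟨_, .inr ((hQ _).2 (.inl ⟨g, hg₁, .inr ⟨ha, rfl⟩⟩)), .inl (hST g hg₁).2⟩
    · obtain ⟨s, hs, H⟩ := hc.gcdPoly ha g hg₁ g' hg₂ hne
      exact ⟨s, .inl hs, H⟩
  · rcases Finset.mem_insert.1 hg with rfl | hg
    · exact ⟨_, .inr ((hQ _).2 (.inr ⟨ha, rfl⟩)), hU⟩
    · obtain ⟨s, hs, H⟩ := hc.annPoly ha g hg
      exact ⟨s, .inl hs, H⟩

/-- A basis all of whose critical polynomials reduce to zero is a strong Gröbner basis; if the lead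
coefficients are invertible, then the S-polynomials suffice. -/
theorem Covers.isStrongGroebnerBasis {all : Prop} {G : Finset (MvPolynomial σ A)}
    (h0 : ∀ g ∈ G, g ≠ 0) (hall : all ∨ ∀ g ∈ G, IsUnit (m.leadingCoeff g))
    (hc : Covers m all G {x | ReducesTo m (G : Set (MvPolynomial σ A)) 0 x}) :
    IsStrongGroebnerBasis m G (Ideal.span (G : Set (MvPolynomial σ A))) := by
  refine isStrongGroebnerBasis_of_topReduces Ideal.subset_span fun f hf hf0 =>
    exists_topReduces_of_mem_span (fun g hg h hh hne => ?_) (fun g hg a ha => ?_)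
      (fun g hg h hh => ?_) hf hf0
  · obtain ⟨s, hs, H | H⟩ := hc.sPoly g hg h hh hne
    · exact ⟨s, H, hs.mem_repSpan_Iio H.eq_zero_or_degree_lt⟩
    · refine ⟨-s, H.symm, neg_mem (hs.mem_repSpan_Iio ?_)⟩
      rw [sup_comm]
      exact H.eq_zero_or_degree_lt
  · rcases hall with hall | hall
    · obtain ⟨s, hs, H⟩ := hc.annPoly hall g hg
      have hs := hs.mem_repSpan_Iio H.eq_zero_or_degree_lt
      obtain ⟨α, hα, rfl⟩ := H
      have : a ∈ Ideal.span {α} := by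
        rw [hα]
        exact (Submodule.mem_annihilator_span_singleton _ _).2 ha
      obtain ⟨β, rfl⟩ := Ideal.mem_span_singleton'.1 this
      rw [map_mul, mul_assoc, C_mul']
      exact Submodule.smul_mem _ _ hs
    -- A unit has zero annihilator.
    · rw [(hall g hg).mul_left_eq_zero] at ha
      simp [ha]
  · rcases hall with hall | hall
    · by_cases hne : g = h
      · subst hne
        exact ⟨g, hg, by simp⟩
      obtain ⟨s, hs, H⟩ := hc.gcdPoly hall g hg h hh hne
      obtain ⟨hs0, hdeg, h₁, h₂⟩ : s ≠ 0 ∧ m.degree s = m.degree g ⊔ m.degree h ∧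
          m.leadingCoeff s ∣ m.leadingCoeff g ∧ m.leadingCoeff s ∣ m.leadingCoeff h := by
        rcases H with H | H
        · exact H.lead (h0 g hg)
        · obtain ⟨e₁, e₂, e₃, e₄⟩ := H.lead (h0 h hh)
          exact ⟨e₁, by rw [e₂, sup_comm], e₄, e₃⟩
      -- A nonzero GCD-polynomial with remainder 0 was top-reduced at least once, so some element of
      -- `G` divides its lead term.
      obtain ⟨k, hk, hkd, hkc⟩ := hs.2.2.resolve_left hs0
      exact ⟨k, hk, hdeg ▸ hkd, hkc.trans h₁, hkc.trans h₂⟩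
    · exact ⟨g, hg, le_sup_left, dvd_rfl, (hall g hg).dvd⟩

end Invariant

/-! ### Arithmetic of the quotients of a principal ideal domain -/

section Residues

variable {R : Type*} [CommRing R]

lemma res_eq_zero_iff {n a : R} : res n a = 0 ↔ n ∣ a := by
  rw [Ideal.Quotient.eq_zero_iff_mem, Ideal.mem_span_singleton]

/-- The projection `R/nR → R/pR` for `p ∣ n`. -/
noncomputable def proj {n p : R} (h : p ∣ n) : Residue n →+* Residue p :=
  Ideal.Quotient.factor (Ideal.span_singleton_le_span_singleton.2 h)

lemma proj_res {n p : R} (h : p ∣ n) (a : R) : proj h (res n a) = res p a :=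
  Ideal.Quotient.factor_mk _ _

lemma proj_comp_res {n p : R} (h : p ∣ n) : (proj h).comp (res n) = res p :=
  RingHom.ext (proj_res h)

lemma proj_surjective {n p : R} (h : p ∣ n) : Function.Surjective (proj h) := fun y => by
  obtain ⟨a, rfl⟩ := Ideal.Quotient.mk_surjective y
  exact ⟨res n a, proj_res h a⟩

/-- This turns the condition that `p` does not divide a lead coefficient into its survival modulo
`p`. -/
lemma proj_eq_zero_iff {n p : R} (h : p ∣ n) {y : Residue n} : proj h y = 0 ↔ res n p ∣ y := by
  obtain ⟨a, rfl⟩ := Ideal.Quotient.mk_surjective y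
  rw [proj_res, res_eq_zero_iff]
  refine ⟨map_dvd _, ?_⟩
  rintro ⟨z, hz⟩
  obtain ⟨b, rfl⟩ := Ideal.Quotient.mk_surjective z
  rw [← map_mul, ← sub_eq_zero, ← map_sub, res_eq_zero_iff] at hz
  exact (dvd_sub_left (dvd_mul_right p b)).1 (h.trans hz)

variable [IsDomain R] [IsPrincipalIdealRing R]

instance isPrincipalIdealRing_residue (n : R) : IsPrincipalIdealRing (Residue n) :=
  IsPrincipalIdealRing.of_surjective (res n) Ideal.Quotient.mk_surjective

/-- For coprime `a` and `c`, some element of `a + cR` is coprime to a given `p ≠ 0`. -/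
lemma exists_isCoprime_add_mul {a c p : R} (hac : IsCoprime a c) (hp : p ≠ 0) :
    ∃ k, IsCoprime (a + c * k) p := by
  classical
  -- The witness is the product of the prime factors of `p` not dividing `a`. Each prime factor of
  -- `p` then divides exactly one of `a` and `c * k`, since one dividing `a` cannot divide `c`.
  refine ⟨(((UniqueFactorizationMonoid.factors p).filter fun π => ¬ π ∣ a)).prod,
    isCoprime_of_prime_dvd (fun h => hp h.2) fun π hπ h₁ h₂ => ?_⟩
  set k := (((UniqueFactorizationMonoid.factors p).filter fun π => ¬ π ∣ a)).prod with hk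
  by_cases hπa : π ∣ a
  · have hck : π ∣ c * k := (dvd_add_right hπa).1 h₁
    rcases hπ.dvd_or_dvd hck with h | h
    · exact hπ.not_isUnit (hac.isUnit_of_dvd' hπa h)
    · obtain ⟨ρ, hρ, hdvd⟩ := hπ.exists_mem_multiset_dvd h
      rw [Multiset.mem_filter] at hρ
      have hρ' := UniqueFactorizationMonoid.prime_of_factor ρ hρ.1
      exact hρ.2 ((hπ.associated_of_dvd hρ' hdvd).dvd'.trans hπa)
  · obtain ⟨ρ, hρ, hdvd⟩ := UniqueFactorizationMonoid.exists_mem_factors_of_dvd hp hπ.irreducible h₂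
    have hmem : ρ ∈ (UniqueFactorizationMonoid.factors p).filter fun π => ¬ π ∣ a :=
      Multiset.mem_filter.2 ⟨hρ, fun h => hπa (hdvd.dvd.trans h)⟩
    have : π ∣ k := hdvd.dvd.trans (Multiset.dvd_prod hmem)
    exact hπa ((dvd_add_left (this.mul_left c)).1 h₁)

/-- Each class modulo `p ≠ 0` is, up to a unit, the class of a divisor of `p`. -/
lemma exists_unit_mul_eq_res {p : R} (hp : p ≠ 0) (c : Residue p) :
    ∃ (u : (Residue p)ˣ) (d : R), d ∣ p ∧ u * c = res p d := by
  obtain ⟨a, rfl⟩ := Ideal.Quotient.mk_surjective c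
  obtain ⟨d, hd⟩ := (IsPrincipalIdealRing.principal (Ideal.span {a, p})).principal
  have hd : Ideal.span {a, p} = Ideal.span {d} := hd
  have ha : d ∣ a := Ideal.mem_span_singleton.1 (hd ▸ Ideal.subset_span (by simp))
  have hdp : d ∣ p := Ideal.mem_span_singleton.1 (hd ▸ Ideal.subset_span (by simp))
  obtain ⟨x, y, hxy⟩ := Ideal.mem_span_pair.1 (hd.ge (Ideal.mem_span_singleton_self d))
  obtain ⟨a', ha'⟩ := ha
  obtain ⟨p', hp'⟩ := id hdp
  have hd0 : d ≠ 0 := by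
    rintro rfl
    exact hp (zero_dvd_iff.1 hdp)
  have hcop : IsCoprime a' p' := ⟨x, y, mul_left_cancel₀ hd0 (by
    linear_combination hxy - x * ha' - y * hp')⟩
  -- With `a = d * a'` and `p = d * p'`, the factor `a'` need not be a unit modulo `p`. Adding a
  -- multiple of `p'` to it leaves `d * a'` unchanged modulo `p` and can make it one.
  obtain ⟨k, w, z, hk⟩ := exists_isCoprime_add_mul hcop hp
  have hw : res p w * res p (a' + p' * k) = 1 := by
    rw [← map_mul, ← sub_eq_zero, ← map_one (res p), ← map_sub, res_eq_zero_iff]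
    exact ⟨-z, by rw [← hk]; ring⟩
  refine ⟨⟨res p w, res p (a' + p' * k), hw, by rw [mul_comm, hw]⟩, d, hdp, ?_⟩
  have hdk : res p a = res p (a' + p' * k) * res p d := by
    rw [← map_mul, ← sub_eq_zero, ← map_sub, res_eq_zero_iff]
    refine ⟨-k, ?_⟩
    conv_rhs => rw [hp']
    rw [ha']
    ring
  change res p w * res p a = res p d
  rw [hdk, ← mul_assoc, hw, one_mul]

/-- The splitting subroutine always finds something. -/
lemma exists_coprime_factors_or_power {n a : R} (hn : n ≠ 0) (ha : res n a ≠ 0)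
    (hu : ¬ IsUnit (res n a)) :
    (∃ p q, ¬ IsUnit p ∧ ¬ IsUnit q ∧ IsCoprime p q ∧ n = p * q) ∨
      ∃ (r : R) (e : ℕ), 1 < e ∧ Associated n (r ^ e) ∧ r ∣ a := by
  -- Without a common prime, `a` and `n` would be coprime and the class of `a` a unit.
  obtain ⟨π, hπ, hπa, hπn⟩ : ∃ π, Prime π ∧ π ∣ a ∧ π ∣ n := by
    by_contra! H
    obtain ⟨x, y, hxy⟩ := isCoprime_of_prime_dvd (fun h => hn h.2) H
    refine hu (IsUnit.of_mul_eq_one_right (res n x) ?_)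
    rw [← map_mul, ← sub_eq_zero, ← map_one (res n), ← map_sub, res_eq_zero_iff]
    exact ⟨-y, by rw [← hxy]; ring⟩
  obtain ⟨c, hnc, hc⟩ :=
    (FiniteMultiplicity.of_prime_left hπ hn).exists_eq_pow_mul_and_not_dvd
  set e := multiplicity π n
  have he : e ≠ 0 := by
    intro he
    rw [he, pow_zero, one_mul] at hnc
    exact hc (hnc ▸ hπn)
  by_cases hcu : IsUnit c
  · have hassoc : Associated n (π ^ e) := hnc ▸ associated_mul_unit_left _ _ hcu
    refine .inr ⟨π, e, ?_, hassoc, hπa⟩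
    -- Exponent 1 would make `n` associated to `π`, which divides `a`, against `ha`.
    by_contra! hle
    rw [show e = 1 by omega, pow_one] at hassoc
    exact ha (res_eq_zero_iff.2 (hassoc.dvd.trans hπa))
  · refine .inl ⟨π ^ e, c, fun h => hπ.not_isUnit ((isUnit_pow_iff he).1 h), hcu, ?_, hnc⟩
    exact ((hπ.irreducible.coprime_iff_not_dvd).2 hc).pow_left

/-- In `R/nR` there are only finitely many elements up to divisibility. -/
lemma wellQuasiOrdered_dvd_residue {n : R} (hn : n ≠ 0) :
    WellQuasiOrdered (fun a b : Residue n => a ∣ b) := by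
  have hn' : Ideal.span {n} ≠ ⊥ := by simpa using hn
  have := Fintype.finite (UniqueFactorizationMonoid.fintypeSubtypeDvd _ hn')
  -- Principal ideals of `R/nR` pull back to divisors of the nonzero ideal `nR`, of which there are
  -- finitely many. Two terms of a sequence with the same pullback divide each other.
  let J : Residue n → {J : Ideal R // J ∣ Ideal.span {n}} := fun c =>
    ⟨(Ideal.span {c}).comap (res n), Ideal.dvd_iff_le.2 <| by
      rw [Ideal.span_singleton_le_iff_mem, Ideal.mem_comap, res_eq_zero_iff.2 dvd_rfl]
      exact zero_mem _⟩
  intro s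
  obtain ⟨i, j, hij, h⟩ := Finite.wellQuasiOrdered (· = ·) fun i => J (s i)
  refine ⟨i, j, hij, ?_⟩
  have h := Ideal.comap_injective_of_surjective (res n) Ideal.Quotient.mk_surjective
    (Subtype.ext_iff.1 h)
  exact Ideal.span_singleton_le_span_singleton.1 h.ge

end Residues

/-! ### Lead terms under coefficient maps -/

section LeadTerms

variable {σ A B : Type*} [CommRing A] [CommRing B] (m : MonomialOrder σ)

lemma degree_map_le (φ : A →+* B) (f : MvPolynomial σ A) : m.degree (map φ f) ≼[m] m.degree f :=
  m.degree_le_iff.2 fun _ hc => m.le_degree (support_map_subset φ f hc)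

lemma degree_map_eq {φ : A →+* B} {f : MvPolynomial σ A} (h : φ (m.leadingCoeff f) ≠ 0) :
    m.degree (map φ f) = m.degree f :=
  degree_eq_of_coeff_ne_zero m (degree_map_le m φ f) (by rwa [coeff_map])

lemma leadingCoeff_map_eq {φ : A →+* B} {f : MvPolynomial σ A} (h : φ (m.leadingCoeff f) ≠ 0) :
    m.leadingCoeff (map φ f) = φ (m.leadingCoeff f) := by
  rw [MonomialOrder.leadingCoeff, degree_map_eq m h, coeff_map]; rfl

lemma degree_C_unit_mul (u : Aˣ) (f : MvPolynomial σ A) :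
    m.degree (C (u : A) * f) = m.degree f := by
  rw [C_mul']
  exact m.degree_smul_of_isRegular u.isUnit.isRegular

lemma leadingCoeff_C_unit_mul (u : Aˣ) (f : MvPolynomial σ A) :
    m.leadingCoeff (C (u : A) * f) = u * m.leadingCoeff f := by
  rw [MonomialOrder.leadingCoeff, degree_C_unit_mul, coeff_C_mul]; rfl

/-- Polynomials lift along surjections with control of the degree and the lead coefficient. -/
lemma exists_lift_degree_le {φ : A →+* B} (hφ : Function.Surjective φ) (g : MvPolynomial σ B)
    {d : A} (hd : φ d = m.leadingCoeff g) :
    ∃ e : MvPolynomial σ A, map φ e = g ∧ m.degree e ≼[m] m.degree g ∧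
      e.coeff (m.degree g) = d := by
  classical
  let e₀ := ∑ v ∈ g.support, monomial v (Function.surjInv hφ (g.coeff v))
  have hmap : map φ e₀ = g := by
    simp only [e₀, map_sum, map_monomial, Function.surjInv_eq hφ]
    exact g.support_sum_monomial_coeff
  have hdeg : m.degree e₀ ≼[m] m.degree g := by
    refine m.degree_sum_le.trans (Finset.sup_le fun v hv => ?_)
    exact (m.degree_monomial_le _).trans (m.le_degree hv)
  -- The coefficientwise lift is corrected at the lead monomial by an element of the kernel of `φ`.
  refine ⟨e₀ + monomial (m.degree g) (d - e₀.coeff (m.degree g)), ?_, ?_, ?_⟩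
  · have : φ (d - e₀.coeff (m.degree g)) = 0 := by
      rw [map_sub, hd, ← coeff_map, hmap]
      exact sub_self _
    rw [map_add, hmap, map_monomial, this, map_zero, add_zero]
  · exact m.degree_add_le.trans (sup_le hdeg (m.degree_monomial_le _))
  · simp

end LeadTerms

/-! ### Lifting from the factors and recombining -/

section Recombination

variable {R σ : Type*} [CommRing R] {m : MonomialOrder σ}

/-- A unit multiple of `g` has the class of a divisor `d` of `p` as lead coefficient, and it lifts
with coefficient `d` there. As `g` is nonzero, `p` does not divide `d`, so the lead monomial
persists over `R/nR`. -/
lemma exists_isNormalizedLift [IsDomain R] [IsPrincipalIdealRing R] {n p : R} (hpn : p ∣ n)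
    (hp : p ≠ 0) {g : Poly σ p} (hg : g ≠ 0) : ∃ g', IsNormalizedLift m n p g g' := by
  obtain ⟨u, d, hdp, hd⟩ := exists_unit_mul_eq_res hp (m.leadingCoeff g)
  have hd' : res p d = m.leadingCoeff (C (u : Residue p) * g) := by
    rw [leadingCoeff_C_unit_mul, hd]
  have hd0 : ¬ p ∣ d := by
    rw [← res_eq_zero_iff, ← hd, Units.mul_right_eq_zero]
    exact m.leadingCoeff_ne_zero_iff.2 hg
  obtain ⟨e, he, hdeg, hcoeff⟩ :=
    exists_lift_degree_le m Ideal.Quotient.mk_surjective (C (u : Residue p) * g) hd'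
  have hdn : ¬ res n p ∣ res n d := by
    rwa [← proj_eq_zero_iff hpn, proj_res, res_eq_zero_iff]
  have hlc : m.leadingCoeff (map (res n) e) = res n d := by
    have hc : (map (res n) e).coeff (m.degree (C (u : Residue p) * g)) = res n d := by
      rw [coeff_map, hcoeff]
    rw [MonomialOrder.leadingCoeff, degree_eq_of_coeff_ne_zero m
      ((degree_map_le m (res n) e).trans hdeg), hc]
    rw [hc]
    intro h0
    exact hdn (h0 ▸ dvd_zero _)
  refine ⟨map (res n) e, ⟨u, e, he, rfl⟩, ?_, ?_⟩
  · rw [hlc]; exact map_dvd _ hdp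
  · rwa [hlc]

lemma exists_isLiftedBasis [IsDomain R] [IsPrincipalIdealRing R] {n p : R} (hpn : p ∣ n)
    (hp : p ≠ 0) (G : Finset (Poly σ p)) : ∃ L, IsLiftedBasis m n p G L := by
  classical
  have h (g : Poly σ p) : ∃ g', g ≠ 0 → IsNormalizedLift m n p g g' := by
    by_cases hg : g = 0
    · exact ⟨0, fun h => absurd hg h⟩
    · exact (exists_isNormalizedLift hpn hp hg).imp fun _ h _ => h
  choose l hl using h
  refine ⟨insert (C (res n p)) ((G.erase 0).image l), l, fun g _ => hl g, fun x => ?_⟩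
  simp only [Finset.mem_insert, Finset.mem_image, Finset.mem_erase]
  refine or_congr_right ⟨?_, ?_⟩
  · rintro ⟨g, ⟨h0, hg⟩, rfl⟩
    exact ⟨g, hg, h0, rfl⟩
  · rintro ⟨g, hg, h0, rfl⟩
    exact ⟨g, ⟨h0, hg⟩, rfl⟩

lemma exists_isRecombination [IsDomain R] [IsPrincipalIdealRing R] {n p q : R} (hn : n ≠ 0)
    (hpq : IsCoprime p q) (h : n = p * q) (Gp : Finset (Poly σ p)) (Gq : Finset (Poly σ q)) :
    ∃ G, IsRecombination m n p q Gp Gq G := by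
  classical
  have hp : p ≠ 0 := fun h0 => hn (by rw [h, h0, zero_mul])
  have hq : q ≠ 0 := fun h0 => hn (by rw [h, h0, mul_zero])
  obtain ⟨Lp, hLp⟩ := exists_isLiftedBasis (m := m) (h ▸ dvd_mul_right p q : p ∣ n) hp Gp
  obtain ⟨Lq, hLq⟩ := exists_isLiftedBasis (m := m) (h ▸ dvd_mul_left q p : q ∣ n) hq Gq
  obtain ⟨u, v, huv⟩ := hpq
  refine ⟨(Lp ×ˢ Lq).image fun x => combine m (res n u) (res n v) (res n p) (res n q) x.1 x.2,
    Lp, Lq, res n u, res n v, hLp, hLq, by rw [← map_mul, ← map_mul, ← map_add, huv, map_one],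
    fun x => ?_⟩
  simp only [Finset.mem_image, Finset.mem_product, Prod.exists]
  constructor
  · rintro ⟨a, b, ⟨ha, hb⟩, rfl⟩
    exact ⟨a, ha, b, hb, rfl⟩
  · rintro ⟨a, ha, b, hb, rfl⟩
    exact ⟨a, b, ⟨ha, hb⟩, rfl⟩

/-- The ideal `⟨f_0 mod n, …, f_{k-1} mod n⟩`. -/
noncomputable abbrev inputIdeal {k : ℕ} (f : Fin k → MvPolynomial σ R) (n : R) :
    Ideal (Poly σ n) :=
  Ideal.span (Set.range fun i => map (res n) (f i))

lemma inputIdeal_eq_map {k : ℕ} (f : Fin k → MvPolynomial σ R) (n : R) :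
    inputIdeal f n = (Ideal.span (Set.range f)).map (map (res n)) := by
  rw [Ideal.map_span, ← Set.range_comp]; rfl

lemma map_proj_mem_inputIdeal {k : ℕ} {f : Fin k → MvPolynomial σ R} {n p : R} (h : p ∣ n)
    {x : Poly σ n} (hx : x ∈ inputIdeal f n) : map (proj h) x ∈ inputIdeal f p := by
  rw [inputIdeal_eq_map] at hx ⊢
  have := Ideal.mem_map_of_mem (map (proj h)) hx
  rwa [Ideal.map_map, show (map (proj h)).comp (map (res n)) = map (σ := σ) (res p) from
    RingHom.ext fun y => by rw [RingHom.comp_apply, map_map, proj_comp_res]] at this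

/-- Over `R`, `e` differs from an element of the ideal of the `f i` by a multiple of `p`; multiplied
by `q`, the difference vanishes modulo `n`. -/
lemma C_mul_map_mem_inputIdeal {k : ℕ} {f : Fin k → MvPolynomial σ R} {n p q : R} (h : n = p * q)
    {e : MvPolynomial σ R} (he : map (res p) e ∈ inputIdeal f p) :
    C (res n q) * map (res n) e ∈ inputIdeal f n := by
  rw [inputIdeal_eq_map] at he ⊢
  obtain ⟨j, hj, hje⟩ := (Ideal.mem_map_iff_of_surjective _
    (map_surjective _ Ideal.Quotient.mk_surjective)).1 he
  have hdvd : C p ∣ e - j := by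
    rw [C_dvd_iff_map_hom_eq_zero (res p) p (fun _ => res_eq_zero_iff), map_sub, hje, sub_self]
  obtain ⟨w, hw⟩ := hdvd
  have : C q * e = C q * j + C n * w := by
    rw [h, map_mul, sub_eq_iff_eq_add.1 hw]; ring
  rw [← map_C, ← map_mul, this, map_add, map_mul _ (C n) w, map_C, res_eq_zero_iff.2 dvd_rfl,
    map_zero, zero_mul, add_zero]
  exact Ideal.mem_map_of_mem _ (Ideal.mul_mem_left _ _ hj)

lemma IsLiftedBasis.leadingCoeff_dvd {n p : R} {G : Finset (Poly σ p)} {L : Finset (Poly σ n)}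
    (hL : IsLiftedBasis m n p G L) {g : Poly σ n} (hg : g ∈ L) : m.leadingCoeff g ∣ res n p := by
  obtain ⟨l, hl, hL⟩ := hL
  rcases (hL g).1 hg with rfl | ⟨g, hgG, hg0, rfl⟩
  · rw [m.leadingCoeff_C]
  · exact (hl g hgG hg0).2.1

lemma IsLiftedBasis.C_mul_mem {k : ℕ} {f : Fin k → MvPolynomial σ R} {n p q : R} (h : n = p * q)
    {G : Finset (Poly σ p)} {L : Finset (Poly σ n)}
    (hG : (G : Set (Poly σ p)) ⊆ inputIdeal f p) (hL : IsLiftedBasis m n p G L) {g : Poly σ n}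
    (hg : g ∈ L) : C (res n q) * g ∈ inputIdeal f n := by
  obtain ⟨l, hl, hL⟩ := hL
  rcases (hL g).1 hg with rfl | ⟨g, hgG, hg0, rfl⟩
  · rw [← map_mul, ← map_mul, mul_comm q p, ← h, res_eq_zero_iff.2 dvd_rfl, map_zero]
    exact zero_mem _
  · obtain ⟨⟨u, e, he, hge⟩, _⟩ := hl g hgG hg0
    rw [← hge]
    exact C_mul_map_mem_inputIdeal h (he ▸ Ideal.mul_mem_left _ _ (hG hgG))

/-- If `p` divides the lead coefficient of `x` (in particular if `x = 0`), the constant `p` serves.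
Otherwise the lead monomial survives modulo `p`, and a reducer found there is lifted. -/
lemma IsLiftedBasis.exists_topReduces {k : ℕ} {f : Fin k → MvPolynomial σ R} {n p : R} (h : p ∣ n)
    {G : Finset (Poly σ p)} {L : Finset (Poly σ n)}
    (hG : IsStrongGroebnerBasis m G (inputIdeal f p)) (hL : IsLiftedBasis m n p G L) {x : Poly σ n}
    (hx : x ∈ inputIdeal f n) : ∃ g ∈ L, TopReduces m g x := by
  have hdvdp := @IsLiftedBasis.leadingCoeff_dvd _ _ _ m n p G L hL
  obtain ⟨l, hl, hL⟩ := hL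
  by_cases hpx : res n p ∣ m.leadingCoeff x
  · refine ⟨C (res n p), (hL _).2 (.inl rfl), ?_, ?_⟩
    · rw [m.degree_C]; exact zero_le
    · rwa [m.leadingCoeff_C]
  have hx' : proj h (m.leadingCoeff x) ≠ 0 := by rwa [Ne, proj_eq_zero_iff]
  have hmx0 : map (proj h) x ≠ 0 := by
    rw [← m.leadingCoeff_ne_zero_iff, leadingCoeff_map_eq m hx']
    exact hx'
  obtain ⟨g, hgG, hdeg, hdvd⟩ := hG.exists_topReduces (map_proj_mem_inputIdeal h hx) hmx0
  rw [degree_map_eq m hx'] at hdeg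
  rw [leadingCoeff_map_eq m hx'] at hdvd
  have hg0 : g ≠ 0 := by
    rintro rfl
    rw [m.leadingCoeff_zero, zero_dvd_iff] at hdvd
    exact hx' hdvd
  have hlL : l g ∈ L := (hL _).2 (.inr ⟨g, hgG, hg0, rfl⟩)
  obtain ⟨⟨u, e, he, hge⟩, hd₁, hd₂⟩ := hl g hgG hg0
  have hlg : proj h (m.leadingCoeff (l g)) ≠ 0 := by rwa [Ne, proj_eq_zero_iff]
  have hmap : map (proj h) (l g) = C (u : Residue p) * g := by
    rw [← hge, map_map, proj_comp_res, he]
  have hdl : m.degree (l g) = m.degree g := by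
    rw [← degree_map_eq m hlg, hmap, degree_C_unit_mul]
  have hcl : proj h (m.leadingCoeff (l g)) = u * m.leadingCoeff g := by
    rw [← leadingCoeff_map_eq m hlg, hmap, leadingCoeff_C_unit_mul]
  refine ⟨l g, hlL, hdl ▸ hdeg, ?_⟩
  obtain ⟨c, hc⟩ : proj h (m.leadingCoeff (l g)) ∣ proj h (m.leadingCoeff x) := by
    rw [hcl, Units.mul_left_dvd]
    exact hdvd
  obtain ⟨c, rfl⟩ := proj_surjective h c
  rw [← map_mul, ← sub_eq_zero, ← map_sub, proj_eq_zero_iff] at hc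
  -- Divisibility modulo `p` lifts because the lead coefficient of `l g` divides `p` itself.
  exact (dvd_sub_left (dvd_mul_right _ c)).1 (hd₁.trans hc)

/-- By `huv`, the coefficient at the common multiple is the product of the two lead coefficients.
These are coprime, so the product divides the lead coefficient of `x`; hence it is nonzero even in
the presence of zero divisors. -/
lemma combine_topReduces {A : Type*} [CommRing A] {u v a b : A} (huv : u * a + v * b = 1)
    {g h x : MvPolynomial σ A} (hga : m.leadingCoeff g ∣ a) (hhb : m.leadingCoeff h ∣ b)
    (hg : TopReduces m g x) (hh : TopReduces m h x) (hx : x ≠ 0) :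
    TopReduces m (combine m u v a b g h) x := by
  have hcop : IsCoprime (m.leadingCoeff g) (m.leadingCoeff h) :=
    IsCoprime.of_isCoprime_of_dvd_left
      (IsCoprime.of_isCoprime_of_dvd_right ⟨u, v, huv⟩ hhb) hga
  have hdvd : m.leadingCoeff g * m.leadingCoeff h ∣ m.leadingCoeff x := hcop.mul_dvd hg.2 hh.2
  have hne : m.leadingCoeff g * m.leadingCoeff h ≠ 0 := fun h0 =>
    m.leadingCoeff_ne_zero_iff.2 hx (zero_dvd_iff.1 (h0 ▸ hdvd))
  have hc : (combine m u v a b g h).coeff (m.degree g ⊔ m.degree h) =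
      m.leadingCoeff g * m.leadingCoeff h := by
    rw [combine, coeff_add, coeff_C_mul, coeff_C_mul, coeff_monomial_sub_mul le_sup_right,
      coeff_monomial_sub_mul le_sup_left]
    linear_combination (m.leadingCoeff g * m.leadingCoeff h) * huv
  have hdeg : m.degree (combine m u v a b g h) = m.degree g ⊔ m.degree h := by
    refine degree_eq_of_coeff_ne_zero m (m.degree_add_le.trans (sup_le ?_ ?_)) (hc ▸ hne)
    · rw [C_mul']
      exact m.degree_smul_le.trans (degree_monomial_sub_mul_le le_sup_right _)
    · rw [C_mul']
      exact m.degree_smul_le.trans (degree_monomial_sub_mul_le le_sup_left _)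
  refine ⟨hdeg ▸ sup_le hg.1 hh.1, ?_⟩
  rw [MonomialOrder.leadingCoeff, hdeg, hc]
  exact hdvd

theorem IsRecombination.isStrongGroebnerBasis {k : ℕ} {f : Fin k → MvPolynomial σ R} {n p q : R}
    (h : n = p * q) {Gp : Finset (Poly σ p)} {Gq : Finset (Poly σ q)} {G : Finset (Poly σ n)}
    (hp : IsStrongGroebnerBasis m Gp (inputIdeal f p))
    (hq : IsStrongGroebnerBasis m Gq (inputIdeal f q)) (hG : IsRecombination m n p q Gp Gq G) :
    IsStrongGroebnerBasis m G (inputIdeal f n) := by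
  obtain ⟨Lp, Lq, u, v, hLp, hLq, huv, hG⟩ := hG
  refine isStrongGroebnerBasis_of_topReduces (fun x hx => ?_) fun x hx hx0 => ?_
  · obtain ⟨ga, hga, gb, hgb, rfl⟩ := (hG x).1 hx
    have h₁ := hLp.C_mul_mem h hp.1.1 hga
    have h₂ := hLq.C_mul_mem (h.trans (mul_comm p q)) hq.1.1 hgb
    rw [combine, map_mul, map_mul]
    refine add_mem ?_ ?_
    · convert Ideal.mul_mem_left _ (C u * monomial (m.degree ga ⊔ m.degree gb - m.degree gb)
        (m.leadingCoeff ga)) h₂ using 1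
      ring
    · convert Ideal.mul_mem_left _ (C v * monomial (m.degree ga ⊔ m.degree gb - m.degree ga)
        (m.leadingCoeff gb)) h₁ using 1
      ring
  · obtain ⟨ga, hga, hra⟩ := hLp.exists_topReduces (h ▸ dvd_mul_right p q) hp hx
    obtain ⟨gb, hgb, hrb⟩ := hLq.exists_topReduces (h ▸ dvd_mul_left q p) hq hx
    exact ⟨_, (hG _).2 ⟨ga, hga, gb, hgb, rfl⟩, combine_topReduces huv (hLp.leadingCoeff_dvd hga)
      (hLq.leadingCoeff_dvd hgb) hra hrb hx0⟩

end Recombination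

/-! ### The invariant of the algorithm, and absence of stuck configurations -/

section Correctness

variable {R σ : Type*} [CommRing R] (m : MonomialOrder σ) (b : Bool) {k : ℕ}
  (f : Fin k → MvPolynomial σ R)

/-- The invariant of Buchberger's algorithm: `G` generates the input ideal, and the critical
polynomials of `G` are in `T`. -/
structure BasisInv {n : R} (pass : Pass) (G : Finset (Poly σ n)) (T : Set (Poly σ n)) : Prop where
  ne_zero : ∀ g ∈ G, g ≠ 0
  isUnit : pass = .trial → ∀ g ∈ G, IsUnit (m.leadingCoeff g)
  span_eq : Ideal.span (G : Set (Poly σ n)) = inputIdeal f n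
  covers : Covers m (Pass.FormsAll b pass) G T

/-- The invariant of the splitting algorithm. -/
def Config.Inv : {n : R} → Config R σ n → Prop
  | _, .start => True
  | n, .loop pass G P =>
    BasisInv m b f pass G (P ∪ {x | ReducesTo m (G : Set (Poly σ n)) 0 x}) ∧
      ∀ x ∈ P, x ∈ inputIdeal f n
  | n, .nf pass G P h =>
    BasisInv m b f pass G (P ∪ {x | ReducesTo m (G : Set (Poly σ n)) 0 x} ∪
      {x | ReducesTo m (G : Set (Poly σ n)) h x}) ∧
      (∀ x ∈ P, x ∈ inputIdeal f n) ∧ h ∈ inputIdeal f n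
  | n, .stopped a => res n a ≠ 0 ∧ ¬ IsUnit (res n a)
  | n, .split p q cp cq => IsCoprime p q ∧ n = p * q ∧ cp.Inv ∧ cq.Inv
  | n, .done G => IsStrongGroebnerBasis m G (inputIdeal f n)

variable {m b f}

lemma BasisInv.mem {n : R} {pass : Pass} {G : Finset (Poly σ n)} {T : Set (Poly σ n)}
    (h : BasisInv m b f pass G T) {g : Poly σ n} (hg : g ∈ G) : g ∈ inputIdeal f n :=
  h.span_eq ▸ Ideal.subset_span hg

lemma BasisInv.mono {n : R} {pass : Pass} {G : Finset (Poly σ n)} {T T' : Set (Poly σ n)}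
    (h : BasisInv m b f pass G T) (hT : T ⊆ T') : BasisInv m b f pass G T' :=
  ⟨h.ne_zero, h.isUnit, h.span_eq, h.covers.mono hT⟩

lemma BasisInv.insert {n : R} {pass : Pass}
    [DecidableEq (Poly σ n)] {G Q : Finset (Poly σ n)} {T : Set (Poly σ n)} {h : Poly σ n}
    (hi : BasisInv m b f pass G T) (hh : h ∈ inputIdeal f n) (h0 : h ≠ 0)
    (hu : pass = .trial → IsUnit (m.leadingCoeff h))
    (hQ : IsNewPairSet m (Pass.FormsAll b pass) G h Q) :
    BasisInv m b f pass (insert h G) (T ∪ Q) where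
  ne_zero g hg := by
    rcases Finset.mem_insert.1 hg with rfl | hg
    exacts [h0, hi.ne_zero g hg]
  isUnit ht g hg := by
    rcases Finset.mem_insert.1 hg with rfl | hg
    exacts [hu ht, hi.isUnit ht g hg]
  span_eq := by
    rw [Finset.coe_insert, Ideal.span_insert, hi.span_eq, sup_eq_right,
      Ideal.span_singleton_le_iff_mem]
    exact hh
  covers := hi.covers.insert hQ

lemma IsInitialBasis.span_eq {n : R} {G : Finset (Poly σ n)}
    (hG : IsInitialBasis (reduceMod f n) G) :
    Ideal.span (G : Set (Poly σ n)) = inputIdeal f n := by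
  refine le_antisymm (Ideal.span_le.2 fun g hg => ?_) (Ideal.span_le.2 ?_)
  · obtain ⟨_, i, rfl⟩ := (hG g).1 hg
    exact Ideal.subset_span ⟨i, rfl⟩
  · rintro _ ⟨i, rfl⟩
    by_cases h : map (res n) (f i) = 0
    · simp only [h]
      exact zero_mem _
    · exact Ideal.subset_span ((hG _).2 ⟨h, i, rfl⟩)

lemma inv_loop_initial {n : R} {pass : Pass} {G P : Finset (Poly σ n)}
    (hu : pass = .trial → ∀ i, reduceMod f n i ≠ 0 → IsUnit (m.leadingCoeff (reduceMod f n i)))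
    (hG : IsInitialBasis (reduceMod f n) G)
    (hP : IsInitialPairSet m (Pass.FormsAll b pass) (reduceMod f n) P) :
    (Config.loop pass G P).Inv m b f := by
  refine ⟨⟨fun g hg => ((hG g).1 hg).1, fun ht g hg => ?_, hG.span_eq,
    (hP.covers hG).mono Set.subset_union_left⟩, hP.subset fun i => Ideal.subset_span ⟨i, rfl⟩⟩
  obtain ⟨h0, i, rfl⟩ := (hG g).1 hg
  exact hu ht i h0

theorem Step.inv {n : R} {c c' : Config R σ n} (h : Step m b f c c') (hc : c.Inv m b f) :
    c'.Inv m b f := by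
  classical
  induction h with
  | startStop i a hi hu ha =>
    exact ⟨ha ▸ m.leadingCoeff_ne_zero_iff.2 hi, ha ▸ hu⟩
  | startTrial G P hu hG hP => exact inv_loop_initial (fun _ => hu) hG hP
  | choose pass G P h hh =>
    refine ⟨hc.1.mono ?_, fun x hx => hc.2 x (Finset.mem_of_mem_erase hx), hc.2 h hh⟩
    -- The removed polynomial is the current remainder, and reduces to itself in no steps.
    rintro x (hx | hx)
    · by_cases hxh : x = h
      · exact .inr (hxh ▸ ReducesTo.refl _ _)
      · exact .inl (.inl (Finset.mem_erase.2 ⟨hxh, hx⟩))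
    · exact .inl (.inr hx)
  | topReduce pass G P g h h' h0 hg hr =>
    refine ⟨hc.1.mono ?_, hc.2.1, hr.mem hc.2.2 (hc.1.mem hg)⟩
    exact Set.union_subset_union_right _ fun x hx => ReducesTo.step hx hg hr
  | nfZero pass G P =>
    refine ⟨hc.1.mono ?_, hc.2.1⟩
    exact Set.union_subset subset_rfl Set.subset_union_right
  | nfAdd pass G P Q h h0 hr hu hQ =>
    refine ⟨(hc.1.insert hc.2.2 h0 hu hQ).mono ?_, fun x hx => ?_⟩
    · rw [Finset.coe_insert, Finset.coe_union]
      -- The cases are the old pairs, the polynomials already reducing to zero, those with remainder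
      -- `h` (which now reduce to zero), and the new pairs.
      rintro x (((hx | hx) | hx) | hx)
      · exact .inl (.inl hx)
      · exact .inr (ReducesTo.mono (Set.subset_insert _ _) hx)
      · exact .inr (ReducesTo.insert hx)
      · exact .inl (.inr hx)
    · rcases Finset.mem_union.1 hx with hx | hx
      · exact hc.2.1 x hx
      · exact hQ.subset (fun g => hc.1.mem) hc.2.2 x hx
  | nfStop G P h a h0 hr hu ha => exact ⟨ha ▸ m.leadingCoeff_ne_zero_iff.2 h0, ha ▸ hu⟩
  | finish pass G =>
    obtain ⟨h, -⟩ := hc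
    rw [Finset.coe_empty, Set.empty_union] at h
    change IsStrongGroebnerBasis _ _ _
    rw [← h.span_eq]
    refine h.covers.isStrongGroebnerBasis h.ne_zero ?_
    cases pass
    · exact .inr (h.isUnit rfl)
    · exact .inl trivial
  | splitFound a p q hp hq hpq hn => exact ⟨hpq, hn, trivial, trivial⟩
  | powerFound a r e he hn hr G P hG hP => exact inv_loop_initial (fun h => nomatch h) hG hP
  | left cp cp' cq h ih => exact ⟨hc.1, hc.2.1, ih hc.2.2.1, hc.2.2.2⟩
  | right cp cq cq' h ih => exact ⟨hc.1, hc.2.1, hc.2.2.1, ih hc.2.2.2⟩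
  | recombine Gp Gq G hG => exact hG.isStrongGroebnerBasis hc.2.1 hc.2.2.1 hc.2.2.2

theorem Reachable.inv {n : R} {c : Config R σ n} (h : Reachable m b f c) : c.Inv m b f := by
  induction h with
  | refl => trivial
  | tail _ hs ih => exact hs.inv ih

/-- The invariant matters at `stopped`, where the class must be a nonzero non-unit for the
subroutine to succeed, and at `split`, where coprimality provides the Bézout coefficients. -/
theorem Config.Inv.exists_step [IsDomain R] [IsPrincipalIdealRing R] {n : R} {c : Config R σ n}
    (hn : n ≠ 0) (hc : c.Inv m b f) : (∃ c', Step m b f c c') ∨ ∃ G, c = .done G := by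
  classical
  induction c with
  | @start n =>
    left
    by_cases hu : ∀ i, reduceMod f n i ≠ 0 → IsUnit (m.leadingCoeff (reduceMod f n i))
    · obtain ⟨G, hG⟩ := exists_isInitialBasis (reduceMod f n)
      obtain ⟨P, hP⟩ := exists_isInitialPairSet m (Pass.FormsAll b .trial) (reduceMod f n)
      exact ⟨_, .startTrial G P hu hG hP⟩
    · push Not at hu
      obtain ⟨i, hi, hu⟩ := hu
      obtain ⟨a, ha⟩ := Ideal.Quotient.mk_surjective (m.leadingCoeff (reduceMod f n i))
      exact ⟨_, .startStop i a hi hu ha⟩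
  | loop pass G P =>
    left
    rcases P.eq_empty_or_nonempty with rfl | ⟨h, hh⟩
    · exact ⟨_, .finish pass G⟩
    · exact ⟨_, .choose pass G P h hh⟩
  | nf pass G P h =>
    left
    by_cases h0 : h = 0
    · subst h0
      exact ⟨_, .nfZero pass G P⟩
    by_cases hr : ∀ g ∈ G, ¬ TopReduces m g h
    · by_cases hu : pass = .trial → IsUnit (m.leadingCoeff h)
      · obtain ⟨Q, hQ⟩ := exists_isNewPairSet m (Pass.FormsAll b pass) G h
        exact ⟨_, .nfAdd pass G P Q h h0 hr hu hQ⟩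
      · push Not at hu
        obtain ⟨rfl, hu⟩ := hu
        obtain ⟨a, ha⟩ := Ideal.Quotient.mk_surjective (m.leadingCoeff h)
        exact ⟨_, .nfStop G P h a h0 hr hu ha⟩
    · push Not at hr
      obtain ⟨g, hg, hr⟩ := hr
      obtain ⟨h', hr⟩ := hr.exists_isTopReduction
      exact ⟨_, .topReduce pass G P g h h' h0 hg hr⟩
  | @stopped n a =>
    left
    rcases exists_coprime_factors_or_power hn hc.1 hc.2 with
      ⟨p, q, hp, hq, hpq, h⟩ | ⟨r, e, he, h, hr⟩
    · exact ⟨_, .splitFound a p q hp hq hpq h⟩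
    · obtain ⟨G, hG⟩ := exists_isInitialBasis (reduceMod f n)
      obtain ⟨P, hP⟩ := exists_isInitialPairSet m (Pass.FormsAll b .full) (reduceMod f n)
      exact ⟨_, .powerFound a r e he h hr G P hG hP⟩
  | split p q cp cq ihp ihq =>
    left
    obtain ⟨hpq, h, hcp, hcq⟩ := hc
    rcases ihp (left_ne_zero_of_mul (h ▸ hn)) hcp with ⟨cp', hs⟩ | ⟨Gp, rfl⟩
    · exact ⟨_, .left cp cp' cq hs⟩
    rcases ihq (right_ne_zero_of_mul (h ▸ hn)) hcq with ⟨cq', hs⟩ | ⟨Gq, rfl⟩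
    · exact ⟨_, .right _ cq cq' hs⟩
    obtain ⟨G, hG⟩ := exists_isRecombination (m := m) hn hpq h Gp Gq
    exact ⟨_, .recombine Gp Gq G hG⟩
  | done G => exact .inr ⟨G, rfl⟩

end Correctness

/-! ### Termination -/

section Termination

variable {R σ : Type*} [CommRing R] {m : MonomialOrder σ} {b : Bool} {k : ℕ}
  {f : Fin k → MvPolynomial σ R}

open Classical in
/-- A basis cannot grow forever by elements that it does not top-reduce. -/
lemma wellFounded_extension [IsDomain R] [IsPrincipalIdealRing R] [Finite σ] {n : R} (hn : n ≠ 0) :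
    WellFounded fun G' G : Finset (Poly σ n) =>
      ∃ h, (∀ g ∈ G, ¬ TopReduces m g h) ∧ G' = insert h G := by
  rw [wellFounded_iff_isEmpty_descending_chain]
  refine ⟨fun ⟨F, hF⟩ => ?_⟩
  choose h hr hins using hF
  have hmono : Monotone F := monotone_nat_of_le_succ fun i => by
    rw [hins]; exact Finset.subset_insert _ _
  -- By Dickson's lemma and the well-quasi-order on `R/nR`, some earlier `h i` top-reduces a later
  -- `h j`, although `h i` already lies in `F j`.
  obtain ⟨i, j, hij, hle⟩ := ((wellQuasiOrdered_le (α := σ →₀ ℕ)).prod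
    (wellQuasiOrdered_dvd_residue hn)) fun i => (m.degree (h i), m.leadingCoeff (h i))
  exact hr j (h i) (hmono (Nat.succ_le_of_lt hij) (by rw [hins]; exact Finset.mem_insert_self _ _))
    hle

lemma acc_done {n : R} (G : Finset (Poly σ n)) :
    Acc (fun c' c => Step m b f c c') (Config.done G) :=
  ⟨_, fun _ h => nomatch h⟩

/-- Three nested inductions: on the growing basis (with arbitrary pairs), on the shrinking pair set,
and on the degree of the remainder. The trial pass can also leave the loop, which `hacc` covers. -/
lemma acc_loop [IsDomain R] [IsPrincipalIdealRing R] [Finite σ] {n : R} (hn : n ≠ 0) {pass : Pass}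
    (hacc : pass = .trial →
      ∀ a, Acc (fun c' c => Step m b f c c') (Config.stopped a : Config R σ n))
    (G P : Finset (Poly σ n)) : Acc (fun c' c => Step m b f c c') (Config.loop pass G P) := by
  classical
  induction G using (wellFounded_extension (m := m) hn).induction generalizing P with
  | _ G ihG =>
  induction P using Finset.strongInduction with
  | H P ihP =>
  refine ⟨_, fun c' hs => ?_⟩
  cases hs with
  | finish => exact acc_done G
  | choose _ _ _ h hh =>
    have hP := Finset.erase_ssubset hh
    generalize P.erase h = P' at hP
    clear hh
    -- The degree with bottom element places `0` strictly below the nonzero constants, so reducing a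
    -- constant to zero also counts as a descent.
    induction h using (InvImage.wf (fun h => m.toWithBotSyn (m.withBotDegree h))
      wellFounded_lt).induction with
    | _ h ih =>
    refine ⟨_, fun c' hs => ?_⟩
    cases hs with
    | topReduce _ _ _ g _ h' h0 hg hr =>
      refine ih h' ((m.withBotDegree_lt_withBotDegree_iff _ _).2 ?_)
      exact hr.eq_zero_or_degree_lt.symm.imp_right fun h => ⟨h, h0⟩
    | nfZero => exact ihP P' hP
    | nfAdd _ _ _ Q _ h0 hr hu hQ => exact ihG _ ⟨h, hr, by congr⟩ _
    | nfStop _ _ _ a h0 hr hu ha => exact hacc rfl a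

/-- Each interleaved step advances one of two accessible configurations, whence the double
induction. -/
lemma acc_split {n p q : R} {cp : Config R σ p} {cq : Config R σ q}
    (hp : Acc (fun c' c => Step m b f c c') cp) (hq : Acc (fun c' c => Step m b f c c') cq) :
    Acc (fun c' c => Step m b f c c') (Config.split p q cp cq : Config R σ n) := by
  induction hp generalizing cq with
  | intro cp hp ihp =>
  induction hq with
  | intro cq hq ihq =>
  refine ⟨_, fun c' hs => ?_⟩
  cases hs with
  | left _ cp' _ h => exact ihp cp' h ⟨_, hq⟩
  | right _ _ cq' h => exact ihq cq' h
  | recombine Gp Gq G hG => exact acc_done G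

theorem acc_start [IsDomain R] [IsPrincipalIdealRing R] [Finite σ] {n : R} (hn : n ≠ 0) :
    Acc (fun c' c => Step m b f c c') (Config.start : Config R σ n) := by
  induction n using (wellFounded_dvdNotUnit (α := R)).induction with
  | _ n ih =>
  have hacc (a : R) : Acc (fun c' c => Step m b f c c') (Config.stopped a : Config R σ n) := by
    refine ⟨_, fun c' hs => ?_⟩
    cases hs with
    | splitFound _ p q hp hq hpq h =>
      have hp0 : p ≠ 0 := left_ne_zero_of_mul (h ▸ hn)
      have hq0 : q ≠ 0 := right_ne_zero_of_mul (h ▸ hn)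
      exact acc_split (ih p ⟨hp0, q, hq, h⟩ hp0) (ih q ⟨hq0, p, hp, h.trans (mul_comm p q)⟩ hq0)
    -- The full pass never returns to `stopped`, so there is no circularity.
    | powerFound => exact acc_loop hn (pass := .full) (fun h => nomatch h) _ _
  refine ⟨_, fun c' hs => ?_⟩
  cases hs with
  | startStop i a => exact hacc a
  | startTrial G P => exact acc_loop hn (fun _ => hacc) G P

end Termination

end SplitGB

theorem theorem4p4 {R : Type*} [CommRing R] [IsDomain R] [IsPrincipalIdealRing R]
    {σ : Type*} [Finite σ] (m : MonomialOrder σ) (b : Bool) (n : R) (hn : n ≠ 0)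
    {k : ℕ} (f : Fin k → MvPolynomial σ R) :
    -- every run is finite
    (¬ ∃ c : ℕ → SplitGB.Config R σ n,
      c 0 = SplitGB.Config.start ∧ ∀ i, SplitGB.Step m b f (c i) (c (i + 1))) ∧
    -- no run gets stuck before the algorithm returns
    (∀ c : SplitGB.Config R σ n, SplitGB.Reachable m b f c →
      (∃ c', SplitGB.Step m b f c c') ∨ ∃ G, c = SplitGB.Config.done G) ∧
    -- whatever is returned is a strong Gröbner basis of the input ideal
    (∀ G : Finset (SplitGB.Poly σ n), SplitGB.Reachable m b f (SplitGB.Config.done G) →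
      SplitGB.IsStrongGroebnerBasis m G
        (Ideal.span (Set.range fun i => MvPolynomial.map (SplitGB.res n) (f i)))) := by
  refine ⟨?_, fun c hc => hc.inv.exists_step hn, fun G hG => hG.inv⟩
  rintro ⟨c, h0, hs⟩
  have hacc : Acc (fun c' c => SplitGB.Step m b f c c') (c 0) := h0 ▸ SplitGB.acc_start hn
  exact (not_acc_iff_exists_descending_chain.2 ⟨c, rfl, hs⟩) hacc
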